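/- **Setting.** Let $1<p<\infty$. For $i=1,2$ a closed rod is given by: a length $L_i>0$; compact simply connected cross-sections $\mathcal A_i(s)\subset\mathbb R^2$, $s\in[0,L_i]$, containing the origin (the point of the midline) and uniformly bounded, such that $\Omega_i=\{(s,\zeta_1,\zeta_2):s\in[0,L_i],\ (\zeta_1,\zeta_2)\in\mathcal A_i(s)\}$ is the closure of an open set; functions $g_i(\xi_1,\xi_2,s)$, convex and positively homogeneous in $(\xi_1,\xi_2)$; an elastic energy density $f_i:\mathbb R^3\times[0,L_i]\to[0,\infty]$, continuous and convex in the first variable, measurable in the second, with $f_i(a,s)\ge C_i|a|^p+D_i$ for some $C_i,D_i>0$ and $f_i(a,s)\to+\infty$ as $g_i(a_1,a_2,s)\uparrow 1$; and an integrable mass density $\rho_i>0$ on $[0,L_i]$. A gravity vector $\mathbf g\in\mathbb R^3$ is also given. A density $\kappa=(k',k'',\omega)\in L^p([0,L_i];\mathbb R^3)$ and initial values $(\hat r,\hat u,\hat v)$ with $\hat u,\hat v$ orthonormal determine $r,u,v:[0,L_i]\to\mathbb R^3$ by $$\dot r=w,\quad \dot u=-k'w+\omega v,\quad \dot v=-k''w-\omega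 u,\quad w=u\times v,\qquad (r,u,v)(0)=(\hat r,\hat u,\hat v),$$ and the rod occupies $\Lambda_i=\mathbf p_i(\Omega_i)$, $\mathbf p_i(s,\zeta_1,\zeta_2)=r(s)+\zeta_1u(s)+\zeta_2v(s)$. For the first rod the initial values $(\hat r_1,\hat u_1,\hat v_1)$ are prescribed. A configuration is $\mathbf z=(\kappa_1;\kappa_2,\hat r_2,\hat u_2,\hat v_2,\hat w_2)\in V=L^p([0,L_1];\mathbb R^3)\times L^p([0,L_2];\mathbb R^3)\times(\mathbb R^3)^4$; its midlines are $r_1[\mathbf z],r_2[\mathbf z]$, and $\Lambda[\mathbf z]=\Lambda_1\cup\Lambda_2$ is the set occupied by the link. Its energy is $$E_{\rm loop}[\mathbf z]=\sum_{i}\Big(\int_0^{L_i}f_i(\kappa_i(s),s)\,ds-\int_0^{L_i}\rho_i(s)\,\mathbf g\cdot r_i(s)\,ds\Big).$$ The linking number of two disjoint closed curves is the Gauss integral $$L(\eta,\tilde\eta)=\frac1{4\pi}\iint\frac{\eta(s)-\tilde\eta(t)}{|\eta(s)-\tilde\eta(t)|^3}\cdot(\eta'(s)\times\tilde\eta'(t))\,ds\,dt.$$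 Given $E\in\mathbb R$, integers $n_1,n_2$ and closed continuous curves $\eta_i:[0,L_i]\to\mathbb R^3$, let $U\subset V$ be the set of all $\mathbf z$ such that: $\hat u_2,\hat v_2$ are orthonormal and $\hat w_2=\hat u_2\times\hat v_2$; $E_{\rm loop}[\mathbf z]<E$; $r_i(0)=r_i(L_i)$ and $w_i(0)=w_i(L_i)$; $\int_{\Omega_i}(1-\zeta_1k_i'-\zeta_2k_i'')\,d(s,\zeta_1,\zeta_2)\le\mathcal L^3(\Lambda_i)$; $\Lambda_1\cap\Lambda_2=\emptyset$; for all small $\delta>0$ the curve $r_i+\delta u_i$, closed by rotating $u_i(L_i)$ to $u_i(0)$ through an angle in $[0,2\pi)$ in the plane orthogonal to $w_i(L_i)$, is disjoint from $r_i$ and has linking number $n_i$ with it; $L(r_1,r_2)=1$; and the link $(r_1,r_2)$ is isotopic to $(\eta_1,\eta_2)$, that is, there are an open neighbourhood $N_1$ of the union of the images of $r_1,r_2$ and a continuous $\Phi:N_1\times[0,1]\to\mathbb R^3$, each $\Phi(\cdot,\tau)$ being a homeomorphism onto its image, such that $\Phi(\cdot,0)=\mathrm{id}$, $\Phi(N_1,1)$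 is an open neighbourhood of the images of $\eta_1,\eta_2$, and $\Phi(\cdot,1)$ maps the image of $r_i$ onto that of $\eta_i$. For $\mathbf z\in U$ let $D[\mathbf z]$ be the set of all smooth embeddings $\gamma:\mathbb S^1\to\mathbb R^3\setminus\Lambda[\mathbf z]$ which are not homotopic to a constant in $\mathbb R^3\setminus\Lambda[\mathbf z]$ and satisfy $L(\gamma,r_1[\mathbf z])=L(\gamma,r_2[\mathbf z])=1$. A set $S\subset\mathbb R^3\setminus\Lambda[\mathbf z]$ is $D$-spanning for $\Lambda[\mathbf z]$, written $S\in F(\Lambda[\mathbf z],D)$, if it is relatively closed in $\mathbb R^3\setminus\Lambda[\mathbf z]$ and meets every $\gamma\in D[\mathbf z]$. Let $U_\varepsilon(\gamma)$ be the open $\varepsilon$-neighbourhood of $\gamma$. **Theorem.** (1) Let $\mathbf z\in U$ and $\gamma\in D[\mathbf z]$. There are $\varepsilon>0$, depending only on $\gamma$ and $\mathbf z$, and $M=M(\varepsilon)>0$, depending only on $\gamma$ and $\varepsilon$ (for fixed data of the system), such that $U_{2\varepsilon}(\gamma)$ is a tubular neighbourhood of $\gamma$ (each of its points has a unique nearest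 point on $\gamma$), $U_{2\varepsilon}(\gamma)\subset\mathbb R^3\setminus\Lambda[\mathbf z]$, and the following holds: whenever $\mathbf z_k\in U$, $\mathbf z_k\rightharpoonup\mathbf z$ weakly in $V$, and $S_k\in F(\Lambda[\mathbf z_k],D)$ for all $k$, there is $k_0$ such that $$\mathcal H^2(S_k\cap U_\varepsilon(\gamma))\ge M\qquad\text{for all }k\ge k_0 .$$ (2) Consequently, let $\mathbf z_k,\mathbf z\in U$, $\mathbf z_k\rightharpoonup\mathbf z$, $S_k\in F(\Lambda[\mathbf z_k],D)$ and $\mathcal H^2(S_k)<\infty$ for all $k$. If $\mu$ is a locally finite Borel measure on $\mathbb R^3$ and some subsequence of the measures $\mathcal H^2\llcorner S_k$ converges weakly-$*$ to $\mu$ (against continuous functions with compact support), then $S_\infty=(\operatorname{supp}\mu)\setminus\Lambda[\mathbf z]$ is $D$-spanning for $\Lambda[\mathbf z]$, i.e. $S_\infty\in F(\Lambda[\mathbf z],D)$. -/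

import Mathlib

open Set Filter Topology MeasureTheory
open scoped ENNReal ContDiff Real CompactlySupported

namespace KirchhoffPlateau

noncomputable section

/-- Euclidean three-space. -/
abbrev E3 : Type := EuclideanSpace ℝ (Fin 3)

/-- The vector product in `E3`. -/
def cross (a b : E3) : E3 := WithLp.toLp 2 (crossProduct (WithLp.ofLp a) (WithLp.ofLp b))

/-! ### Curves: linking number and isotopy -/

/-- The Gauss linking integral of `η₁` on `[a, b]` and `η₂` on `[c, d]`. It is used only for
absolutely continuous closed curves that are disjoint. -/
def linkingNumber (η₁ : ℝ → E3) (a b : ℝ) (η₂ : ℝ → E3) (c d : ℝ) : ℝ :=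
  1 / (4 * π) * ∫ s in a..b, ∫ t in c..d,
    inner ℝ ((1 / ‖η₁ s - η₂ t‖ ^ 3) • (η₁ s - η₂ t)) (cross (deriv η₁ s) (deriv η₂ t))

/-- The two-component links `A₁ ∪ A₂` and `B₁ ∪ B₂` are isotopic: a continuous family of
homeomorphisms `Φ (·, τ)` of an open neighbourhood `N₁` of `A₁ ∪ A₂` onto its images starts at the
identity and ends with a map onto an open neighbourhood `N₂` of `B₁ ∪ B₂` that carries `A₁` onto
`B₁` and `A₂` onto `B₂`. -/
def LinkIsotopic (A₁ A₂ B₁ B₂ : Set E3) : Prop :=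
  ∃ N₁ N₂ : Set E3, IsOpen N₁ ∧ IsOpen N₂ ∧ A₁ ∪ A₂ ⊆ N₁ ∧ B₁ ∪ B₂ ⊆ N₂ ∧
    ∃ Φ : E3 × ℝ → E3, ContinuousOn Φ (N₁ ×ˢ Icc (0 : ℝ) 1) ∧
      (∀ τ ∈ Icc (0 : ℝ) 1, IsEmbedding (N₁.domRestrict fun x => Φ (x, τ))) ∧
      (∀ x ∈ N₁, Φ (x, 0) = x) ∧
      (fun x => Φ (x, 1)) '' N₁ = N₂ ∧
      (fun x => Φ (x, 1)) '' A₁ = B₁ ∧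
      (fun x => Φ (x, 1)) '' A₂ = B₂

/-! ### A single rod -/

/-- The material data of a rod, with the assumptions made on them. The densities of the rod are
written as a vector `(k', k'', ω)`: the two flexural densities and the twist density. -/
structure Rod (p : ℝ≥0∞) where
  /-- length of the midline -/
  L : ℝ
  L_pos : 0 < L
  /-- the material cross-section at `s`, in coordinates `(ζ₁, ζ₂)` centred on the midline -/
  crossSection : ℝ → Set (ℝ × ℝ)
  isCompact_crossSection : ∀ s ∈ Icc 0 L, IsCompact (crossSection s)
  simplyConnected_crossSection : ∀ s ∈ Icc 0 L, SimplyConnectedSpace (crossSection s)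
  zero_mem_crossSection : ∀ s ∈ Icc 0 L, (0, 0) ∈ crossSection s
  /-- maximal thickness -/
  R : ℝ
  thickness : ∀ s ∈ Icc 0 L, ∀ ζ ∈ crossSection s, |ζ.1| < R ∧ |ζ.2| < R
  closure_of_open : ∃ O : Set (ℝ × ℝ × ℝ), IsOpen O ∧
    {x : ℝ × ℝ × ℝ | x.1 ∈ Icc 0 L ∧ x.2 ∈ crossSection x.1} = closure O
  /-- the function whose value `1` on the flexural densities means complete local compression -/
  g : ℝ → ℝ → ℝ → ℝ
  convex_g : ∀ s ∈ Icc 0 L, ConvexOn ℝ univ fun ξ : ℝ × ℝ => g ξ.1 ξ.2 s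
  homogeneous_g : ∀ s ∈ Icc 0 L, ∀ ξ₁ ξ₂ c : ℝ, 0 ≤ c → g (c * ξ₁) (c * ξ₂) s = c * g ξ₁ ξ₂ s
  g_zero : ∀ s ∈ Icc 0 L, g 0 0 s = 0
  /-- the density of elastic energy (it may be infinite) -/
  f : E3 → ℝ → ℝ≥0∞
  continuous_f : ∀ s ∈ Icc 0 L, Continuous fun a => f a s
  convex_f : ∀ s ∈ Icc 0 L, ∀ a b : E3, ∀ t ∈ Icc (0 : ℝ) 1,
    f (t • a + (1 - t) • b) s ≤ ENNReal.ofReal t * f a s + ENNReal.ofReal (1 - t) * f b s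
  measurable_f : ∀ a, Measurable fun s : Icc 0 L => f a s
  coercive_f : ∃ C D : ℝ, 0 < C ∧ 0 < D ∧ ∀ a, ∀ s ∈ Icc 0 L,
    ENNReal.ofReal (C * ‖a‖ ^ p.toReal + D) ≤ f a s
  /-- the energy density blows up as complete compression is approached -/
  blowup_f : ∀ s ∈ Icc 0 L,
    Tendsto (fun a => f a s) (comap (fun a : E3 => g (a 0) (a 1) s) (𝓝[<] 1)) (𝓝 ⊤)
  /-- linear mass density -/
  ρ : ℝ → ℝ
  ρ_pos : ∀ s ∈ Icc 0 L, 0 < ρ s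
  integrable_ρ : IntegrableOn ρ (Icc 0 L)

variable {p : ℝ≥0∞}

/-- The set `Ω` of material coordinates `(s, ζ₁, ζ₂)`. -/
def Rod.Ω (B : Rod p) : Set (ℝ × ℝ × ℝ) :=
  {x | x.1 ∈ Icc 0 B.L ∧ x.2 ∈ B.crossSection x.1}

/-- The space `L^p([0, L]; ℝ³)` of densities `(k', k'', ω)`. -/
abbrev Rod.Density (B : Rod p) : Type := Lp E3 p (volume.restrict (Icc 0 B.L))

/-- A triple `(r, u, v)` of the midline and of two directors, as functions of arc length. -/
structure Frame where
  r : ℝ → E3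
  u : ℝ → E3
  v : ℝ → E3

/-- The unit tangent `w = u × v`. -/
def Frame.w (F : Frame) (s : ℝ) : E3 := cross (F.u s) (F.v s)

/-- `(r, u, v)` solves on `[0, L]` the initial value problem
`r' = w`, `u' = -k' w + ω v`, `v' = -k'' w - ω u`, where `w = u × v`, with the initial values
`(r₀, u₀, v₀)`, in the sense of Carathéodory (as integral equations). -/
structure SolvesIVP (L : ℝ) (κ : ℝ → E3) (r₀ u₀ v₀ : E3) (F : Frame) : Prop where
  continuousOn_r : ContinuousOn F.r (Icc 0 L)
  continuousOn_u : ContinuousOn F.u (Icc 0 L)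
  continuousOn_v : ContinuousOn F.v (Icc 0 L)
  eq_r : ∀ s ∈ Icc 0 L, F.r s = r₀ + ∫ t in (0 : ℝ)..s, F.w t
  eq_u : ∀ s ∈ Icc 0 L, F.u s = u₀ + ∫ t in (0 : ℝ)..s, (-κ t 0) • F.w t + κ t 2 • F.v t
  eq_v : ∀ s ∈ Icc 0 L, F.v s = v₀ + ∫ t in (0 : ℝ)..s, (-κ t 1) • F.w t - κ t 2 • F.u t

open Classical in
/-- The solution of the initial value problem. (For integrable densities and orthonormal initial
directors it exists and is unique on `[0, L]`; the value in the other case is irrelevant.) -/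
def solution (L : ℝ) (κ : ℝ → E3) (r₀ u₀ v₀ : E3) : Frame :=
  if h : ∃ F, SolvesIVP L κ r₀ u₀ v₀ F then h.choose else ⟨0, 0, 0⟩

/-- `u₀`, `v₀` are orthonormal (so that `u₀`, `v₀`, `u₀ × v₀` is an orthonormal frame). -/
def IsOrthonormalPair (u₀ v₀ : E3) : Prop := ‖u₀‖ = 1 ∧ ‖v₀‖ = 1 ∧ inner ℝ u₀ v₀ = 0

/-- The position in space of the material point with coordinates `(s, ζ₁, ζ₂)`. -/
def Frame.position (F : Frame) (x : ℝ × ℝ × ℝ) : E3 :=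
  F.r x.1 + x.2.1 • F.u x.1 + x.2.2 • F.v x.1

/-- The region occupied by the rod `B` with midline and directors `F`. -/
def Rod.body (B : Rod p) (F : Frame) : Set E3 := F.position '' B.Ω

/-- The rod is closed: the midline closes up, and so does its tangent. -/
def Frame.IsClosedUp (F : Frame) (L : ℝ) : Prop := F.r 0 = F.r L ∧ F.w 0 = F.w L

/-- The curve `r + δ u` near the midline on `[0, L]`, followed on `[L, L + 1]` by the circular arc
of angle `φ` around the midline, in the plane of the terminal cross-section. -/
def Frame.nearCurve (F : Frame) (L δ φ : ℝ) (s : ℝ) : E3 :=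
  if s ≤ L then F.r s + δ • F.u s
  else F.r L + δ • (Real.cos ((s - L) * φ) • F.u L + Real.sin ((s - L) * φ) • F.v L)

/-- The number of turns of the rod: the linking number of the midline and of a curve near it is `n`.
The near curve `r + δ u` is closed by the rotation through an angle `φ ∈ [0, 2π)` which carries
the last director `u L` to the first one `u 0`. -/
def Frame.HasSelfLinking (F : Frame) (L : ℝ) (n : ℤ) : Prop :=
  ∃ φ ∈ Ico 0 (2 * π), F.u 0 = Real.cos φ • F.u L + Real.sin φ • F.v L ∧
    ∀ᶠ δ in 𝓝[>] (0 : ℝ),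
      Disjoint (F.r '' Icc 0 L) (F.nearCurve L δ φ '' Icc 0 (L + 1)) ∧
      linkingNumber F.r 0 L (F.nearCurve L δ φ) 0 (L + 1) = n

/-- Global non-interpenetration of a rod (Ciarlet--Nečas condition); `1 - ζ₁ k' - ζ₂ k''` is the
Jacobian determinant of the position map. -/
def Rod.NonInterpenetrating (B : Rod p) (κ : ℝ → E3) (F : Frame) : Prop :=
  ∫ x in B.Ω, (1 - x.2.1 * κ x.1 0 - x.2.2 * κ x.1 1) ≤ (volume (B.body F)).toReal

/-- Elastic energy of a rod. -/
def Rod.elasticEnergy (B : Rod p) (κ : ℝ → E3) : ℝ≥0∞ := ∫⁻ s in Icc 0 B.L, B.f (κ s) s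

/-- Potential energy of the weight of a rod in the gravity field `grav`. -/
def Rod.weightEnergy (B : Rod p) (grav : E3) (F : Frame) : ℝ :=
  -∫ s in (0 : ℝ)..B.L, B.ρ s * inner ℝ grav (F.r s)

/-! ### The link formed by two rods -/

/-- The data of the system: two rods, the clamping of the first one, the gravity vector. -/
structure LinkSystem (p : ℝ≥0∞) where
  rod₁ : Rod p
  rod₂ : Rod p
  r₁ : E3
  u₁ : E3
  v₁ : E3
  orthonormal_clamp : IsOrthonormalPair u₁ v₁
  grav : E3

/-- The space `V = V₁ × V₂` of configurations `z`: the densities of the first rod; the densities of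
the second rod together with its initial values `(r₂, u₂, v₂, w₂)`. -/
abbrev LinkSystem.V (Y : LinkSystem p) : Type :=
  Y.rod₁.Density × (Y.rod₂.Density × E3 × E3 × E3 × E3)

/-- Midline and directors of the first rod in the configuration `z`. -/
def LinkSystem.frame₁ (Y : LinkSystem p) (z : Y.V) : Frame :=
  solution Y.rod₁.L z.1 Y.r₁ Y.u₁ Y.v₁

/-- Midline and directors of the second rod in the configuration `z`. -/
def LinkSystem.frame₂ (Y : LinkSystem p) (z : Y.V) : Frame :=
  solution Y.rod₂.L z.2.1 z.2.2.1 z.2.2.2.1 z.2.2.2.2.1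

/-- The closed set `Λ[z]` occupied by the link. -/
def LinkSystem.Λ (Y : LinkSystem p) (z : Y.V) : Set E3 :=
  Y.rod₁.body (Y.frame₁ z) ∪ Y.rod₂.body (Y.frame₂ z)

/-- The energy of the link: elastic energy plus potential energy of the weight. -/
def LinkSystem.loopEnergy (Y : LinkSystem p) (z : Y.V) : EReal :=
  ((Y.rod₁.elasticEnergy z.1 + Y.rod₂.elasticEnergy z.2.1 : ℝ≥0∞) : EReal) +
    ((Y.rod₁.weightEnergy Y.grav (Y.frame₁ z) + Y.rod₂.weightEnergy Y.grav (Y.frame₂ z) : ℝ) :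
      EReal)

/-- The class `U` of admissible configurations. -/
structure LinkSystem.IsAdmissible (Y : LinkSystem p) (Emax : ℝ) (n₁ n₂ : ℤ) (η₁ η₂ : ℝ → E3)
    (z : Y.V) : Prop where
  orthonormal : IsOrthonormalPair z.2.2.2.1 z.2.2.2.2.1
  tangent : z.2.2.2.2.2 = cross z.2.2.2.1 z.2.2.2.2.1
  energy : Y.loopEnergy z < (Emax : EReal)
  closed₁ : (Y.frame₁ z).IsClosedUp Y.rod₁.L
  closed₂ : (Y.frame₂ z).IsClosedUp Y.rod₂.L
  nonInterpenetrating₁ : Y.rod₁.NonInterpenetrating z.1 (Y.frame₁ z)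
  nonInterpenetrating₂ : Y.rod₂.NonInterpenetrating z.2.1 (Y.frame₂ z)
  disjoint : Disjoint (Y.rod₁.body (Y.frame₁ z)) (Y.rod₂.body (Y.frame₂ z))
  selfLinking₁ : (Y.frame₁ z).HasSelfLinking Y.rod₁.L n₁
  selfLinking₂ : (Y.frame₂ z).HasSelfLinking Y.rod₂.L n₂
  linked : linkingNumber (Y.frame₁ z).r 0 Y.rod₁.L (Y.frame₂ z).r 0 Y.rod₂.L = 1
  isotopic : LinkIsotopic ((Y.frame₁ z).r '' Icc 0 Y.rod₁.L) ((Y.frame₂ z).r '' Icc 0 Y.rod₂.L)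
    (η₁ '' Icc 0 Y.rod₁.L) (η₂ '' Icc 0 Y.rod₂.L)

/-- Weak convergence `z_k ⇀ z` of configurations. -/
def LinkSystem.WeakTendsto [Fact (1 ≤ p)] (Y : LinkSystem p) (zs : ℕ → Y.V) (z : Y.V) : Prop :=
  Tendsto (fun k => toWeakSpace ℝ Y.V (zs k)) atTop (𝓝 (toWeakSpace ℝ Y.V z))

/-! ### Spanning sets -/

/-- `γ` is a smooth embedding of the circle into space (a smooth injective immersion; the circle
is compact). -/
structure IsSmoothLoop (γ : Circle → E3) : Prop where
  contDiff : ContDiff ℝ ∞ fun t : ℝ => γ (Circle.exp t)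
  deriv_ne_zero : ∀ t : ℝ, deriv (fun t : ℝ => γ (Circle.exp t)) t ≠ 0
  injective : Function.Injective γ

/-- The family `C_H` of smooth embeddings of the circle into the complement of `H`. -/
def smoothLoops (H : Set E3) : Set (Circle → E3) := {γ | IsSmoothLoop γ ∧ ∀ x, γ x ∈ Hᶜ}

/-- The family `F(H, C)` of `C`-spanning sets of `H`: the relatively closed subsets of the
complement of `H` which meet every loop in `C`. -/
def spanningFamily (H : Set E3) (C : Set (Circle → E3)) : Set (Set E3) :=
  {K | (∃ T, IsClosed T ∧ K = T ∩ Hᶜ) ∧ ∀ γ ∈ C, (K ∩ range γ).Nonempty}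

/-- The family `D` of the configuration `z`: the smooth embeddings of the circle into the complement
of `Λ[z]` which are not homotopic to a constant in this complement and which have linking number one
with both rods. -/
def LinkSystem.D (Y : LinkSystem p) (z : Y.V) : Set (Circle → E3) :=
  {γ | γ ∈ smoothLoops (Y.Λ z) ∧
    (∃ h : C(Circle, ↥(Y.Λ z)ᶜ), (∀ x, (h x : E3) = γ x) ∧ ¬ h.Nullhomotopic) ∧
    linkingNumber (fun t : ℝ => γ (Circle.exp t)) 0 (2 * π) (Y.frame₁ z).r 0 Y.rod₁.L = 1 ∧
    linkingNumber (fun t : ℝ => γ (Circle.exp t)) 0 (2 * π) (Y.frame₂ z).r 0 Y.rod₂.L = 1}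

/-- The open neighbourhood `U_ε(γ)` of radius `ε` of the loop `γ`. -/
def tube (γ : Circle → E3) (ε : ℝ) : Set E3 := Metric.thickening ε (range γ)

/-- `U_ε(γ)` is a tubular neighbourhood: each of its points has a unique nearest point on `γ`. -/
def IsTubular (γ : Circle → E3) (ε : ℝ) : Prop :=
  ∀ x ∈ tube γ ε, ∃! y, y ∈ range γ ∧ dist x y = Metric.infDist x (range γ)

/-- Weak-star convergence of measures, tested on continuous functions with compact support. -/
def WeakStarTendsto (μs : ℕ → Measure E3) (μ : Measure E3) : Prop :=
  ∀ f : C_c(E3, ℝ), Tendsto (fun k => ∫ x, f x ∂(μs k)) atTop (𝓝 (∫ x, f x ∂μ))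

end

end KirchhoffPlateau

open KirchhoffPlateau

/-!
Loops that lie close to `γ ∈ D[z]` are used as test curves, and only the translates `γ + a` with
`|a| < ε` are needed.

*Area bound.* If `S` meets every translate `γ + a`, `|a| < ε`, cover `S ∩ U_ε(γ)` by small sets
`A`. The set `A` meets only the translates with `a ∈ A - γ`, a tube about a curve of length `O(1)`
and of radius `diam A`, whose volume is at most a constant times `(diam A)²`. The vectors `a` fill
the `ε`-ball, so the two-dimensional Hausdorff measure of `S ∩ U_ε(γ)` is at least a constant times
`ε³` (`le_hausdorffMeasure_of_meets_translates`); the constant depends only on a Lipschitz constant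
of `γ`. No regularity of `S` enters. The unique nearest points in `U_{2ε}(γ)` come from
`IsSmoothLoop.exists_isTubular`.

*Translates are admissible test curves* (`LinkSystem.IsAdmissible.translate_mem_D`). If `γ` has
distance at least `2ε` from `Λ[z]` and every material point of `z_k` is within `ε` of its position
in `z`, then `γ + a` avoids `Λ[z_k]`. Moving `γ` to `γ + a` and the midlines of `z` to those
of `z_k` along straight segments never makes the curves meet, and the Gauss integral is
constant along such a deformation, because the Gauss form is closed
(`gaussIntegral_eq_of_segments`, from `coulombDeriv_alternating`). The linking numbers thus
remain `1`. A loop that is null-homotopic in the complement of the link has linking number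
zero with the midlines (`not_nullhomotopic_of_linkingNumber_ne_zero`): the continuous
homotopy is smoothed by averaging and cut into steps small enough for the straight-line
invariance, so that neither the integrality of the linking number
nor a degree theory is needed.

*Weak convergence moves material points uniformly*
(`LinkSystem.WeakTendsto.eventually_position_close`). The director equations have solutions
(`exists_solvesIVP`), and along them `|u|² + |v|²` is constant, because `u × v` is orthogonal to
both directors. With the directors of the limit frozen, the right-hand sides depend linearly on the
density; they converge pointwise after integration by weak convergence, and uniformly because
Hölder's inequality with `p > 1` makes the integrals equicontinuous
(`eventually_norm_drift_sub_le`). Gronwall's inequality then bounds the difference of the frames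
(`eventually_frame_close`).

The three facts together give `LinkSystem.IsAdmissible.exists_area_lower_bound`, the first
assertion. For the second, if a loop `γ ∈ D[z]` missed the support of the limit measure, a
continuous function that is `1` on a tube about `γ` and vanishes on the support would have integral
`0` in the limit, although its integrals against the area measures of the `S_k` stay above a
positive bound (`LinkSystem.IsAdmissible.support_inter_range_nonempty`).
-/

open Set Filter Topology MeasureTheory
open scoped ENNReal ContDiff Real CompactlySupported

namespace KirchhoffPlateau

/-! ### The vector product and the closedness of the Gauss form -/

lemma cross_zero_apply (a b : E3) : cross a b 0 = a 1 * b 2 - a 2 * b 1 := by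
  simp [cross, cross_apply]

lemma cross_one_apply (a b : E3) : cross a b 1 = a 2 * b 0 - a 0 * b 2 := by
  simp [cross, cross_apply]

lemma cross_two_apply (a b : E3) : cross a b 2 = a 0 * b 1 - a 1 * b 0 := by
  simp [cross, cross_apply]

lemma inner_E3 (a b : E3) : inner ℝ a b = a 0 * b 0 + a 1 * b 1 + a 2 * b 2 := by
  simp [PiLp.inner_apply, Fin.sum_univ_three, mul_comm]

lemma norm_cross_le (a b : E3) : ‖cross a b‖ ≤ ‖a‖ * ‖b‖ := by
  refine abs_le_of_sq_le_sq' ?_ (by positivity) |>.2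
  rw [mul_pow, EuclideanSpace.real_norm_sq_eq, EuclideanSpace.real_norm_sq_eq,
    EuclideanSpace.real_norm_sq_eq]
  simp only [Fin.sum_univ_three, cross_zero_apply, cross_one_apply, cross_two_apply]
  nlinarith [sq_nonneg (a 0 * b 0 + a 1 * b 1 + a 2 * b 2)]

/-- The vector product as a continuous bilinear map. -/
noncomputable def crossL : E3 →L[ℝ] E3 →L[ℝ] E3 :=
  LinearMap.mkContinuous₂ (LinearMap.mk₂ ℝ cross
    (fun a b c => by simp [cross]) (fun c a b => by simp [cross])
    (fun a b c => by simp [cross]) (fun c a b => by simp [cross])) 1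
    (fun a b => by rw [one_mul]; exact norm_cross_le a b)

@[simp]
lemma crossL_apply (a b : E3) : crossL a b = cross a b := rfl

lemma cross_sub_left (a b c : E3) : cross (a - b) c = cross a c - cross b c := by simp [cross]

lemma cross_sub_right (a b c : E3) : cross a (b - c) = cross a b - cross a c := by simp [cross]

lemma cross_neg_right (a b : E3) : cross a (-b) = -cross a b := by
  simp only [cross, WithLp.ofLp_neg, map_neg, WithLp.toLp_neg]

lemma cross_zero_left (b : E3) : cross 0 b = 0 := by simp [cross]

lemma cross_zero_right (b : E3) : cross b 0 = 0 := by simp [cross]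

lemma cross_swap (a b : E3) : cross a b = -cross b a := by
  simp only [cross, ← WithLp.toLp_neg, cross_anticomm]

lemma _root_.ContinuousOn.cross {X : Type*} [TopologicalSpace X] {f g : X → E3} {s : Set X}
    (hf : ContinuousOn f s) (hg : ContinuousOn g s) :
    ContinuousOn (fun x => cross (f x) (g x)) s :=
  (crossL.continuous.comp_continuousOn hf).clm_apply hg

lemma _root_.Continuous.cross {X : Type*} [TopologicalSpace X] {f g : X → E3}
    (hf : Continuous f) (hg : Continuous g) : Continuous fun x => cross (f x) (g x) :=
  (crossL.continuous.comp hf).clm_apply hg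

lemma _root_.HasDerivAt.cross {f g : ℝ → E3} {f' g' : E3} {x : ℝ}
    (hf : HasDerivAt f f' x) (hg : HasDerivAt g g' x) :
    HasDerivAt (fun y => cross (f y) (g y)) (cross (f x) g' + cross f' (g x)) x :=
  crossL.hasDerivAt_of_bilinear (fun _ => hf) (fun _ => hg)

lemma inner_cross_left_eq_zero (a b : E3) : inner ℝ a (cross a b) = 0 := by
  simp only [inner_E3, cross_zero_apply, cross_one_apply, cross_two_apply]; ring

lemma inner_cross_right_eq_zero (a b : E3) : inner ℝ b (cross a b) = 0 := by
  simp only [inner_E3, cross_zero_apply, cross_one_apply, cross_two_apply]; ring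

/-- The Coulomb field `x / |x|³`, the kernel of the Gauss integral. -/
noncomputable def coulomb (x : E3) : E3 := (1 / ‖x‖ ^ 3) • x

/-- The derivative of the Coulomb field at `x` in direction `h`. -/
noncomputable def coulombDeriv (x h : E3) : E3 :=
  (1 / ‖x‖ ^ 3) • h - (3 * inner ℝ x h / ‖x‖ ^ 5) • x

lemma _root_.HasDerivAt.coulomb {X : ℝ → E3} {X' : E3} {t : ℝ} (hX : HasDerivAt X X' t)
    (h0 : X t ≠ 0) :
    HasDerivAt (fun y => coulomb (X y)) (coulombDeriv (X t) X') t := by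
  have hn : ‖X t‖ ≠ 0 := norm_ne_zero_iff.2 h0
  have h1 : HasDerivAt (fun y => ‖X y‖) (inner ℝ (X t) X' / ‖X t‖) t := by
    have h2 : HasDerivAt (fun y => ‖X y‖ ^ 2) (2 * inner ℝ (X t) X') t := hX.norm_sq
    have h3 := h2.sqrt (pow_ne_zero 2 hn)
    simp only [Real.sqrt_sq (norm_nonneg _)] at h3
    convert h3 using 1
    field_simp
  have h4 := ((hasDerivAt_const t (1 : ℝ)).div (h1.pow 3) (pow_ne_zero 3 hn)).smul hX
  refine h4.congr_deriv ?_
  rw [coulombDeriv, sub_eq_add_neg _ ((_ : ℝ) • X t), ← neg_smul]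
  simp only [Pi.div_apply, Pi.pow_apply]
  congr 2
  field_simp
  ring

lemma continuousOn_coulomb : ContinuousOn coulomb {x | x ≠ 0} := by
  refine ContinuousOn.smul (continuousOn_const.div (continuous_norm.pow 3).continuousOn ?_)
    continuousOn_id
  intro x hx
  exact pow_ne_zero 3 (norm_ne_zero_iff.2 hx)

lemma continuousOn_coulombDeriv :
    ContinuousOn (fun q : E3 × E3 => coulombDeriv q.1 q.2) {q | q.1 ≠ 0} := by
  have h (n : ℕ) : ∀ q ∈ {q : E3 × E3 | q.1 ≠ 0}, ‖q.1‖ ^ n ≠ 0 := fun q hq =>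
    pow_ne_zero n (norm_ne_zero_iff.2 hq)
  have hc (n : ℕ) : ContinuousOn (fun q : E3 × E3 => ‖q.1‖ ^ n) {q | q.1 ≠ 0} := by fun_prop
  refine ContinuousOn.sub ((continuousOn_const.div (hc 3) (h 3)).smul continuousOn_snd) ?_
  refine ContinuousOn.smul (ContinuousOn.div ?_ (hc 5) (h 5)) continuousOn_fst
  exact continuousOn_const.mul (continuousOn_fst.inner continuousOn_snd)

/-- The Coulomb field is divergence free, written as an identity for a trilinear alternating form:
for linear `A`, `⟨A a, b × c⟩ + ⟨A b, c × a⟩ + ⟨A c, a × b⟩ = (tr A) det (a, b, c)`. -/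
lemma coulombDeriv_alternating {x : E3} (hx : x ≠ 0) (a b c : E3) :
    inner ℝ (coulombDeriv x a) (cross b c) + inner ℝ (coulombDeriv x b) (cross c a)
      + inner ℝ (coulombDeriv x c) (cross a b) = 0 := by
  have hn : ‖x‖ ≠ 0 := norm_ne_zero_iff.2 hx
  have hsq : ‖x‖ ^ 2 = x 0 ^ 2 + x 1 ^ 2 + x 2 ^ 2 := by
    rw [EuclideanSpace.real_norm_sq_eq, Fin.sum_univ_three]
  simp only [coulombDeriv, inner_sub_left, real_inner_smul_left]
  have h3 : (1 : ℝ) / ‖x‖ ^ 3 = ‖x‖ ^ 2 / ‖x‖ ^ 5 := by field_simp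
  rw [h3, hsq]
  simp only [inner_E3, cross_zero_apply, cross_one_apply, cross_two_apply]
  ring

/-! ### Homotopy invariance of the Gauss integral -/

lemma integrable_box_of_continuousOn {f : ℝ × ℝ × ℝ → ℝ} {a b c d : ℝ}
    (hf : ContinuousOn f (Icc a b ×ˢ Icc c d ×ˢ Icc 0 1)) :
    Integrable f ((volume.restrict (Icc a b)).prod
      ((volume.restrict (Icc c d)).prod (volume.restrict (Icc (0 : ℝ) 1)))) := by
  rw [Measure.prod_restrict, Measure.prod_restrict]
  exact hf.integrableOn_compact (isCompact_Icc.prod (isCompact_Icc.prod isCompact_Icc))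

lemma setIntegral_deriv_eq_sub {f f' : ℝ → ℝ} {a b : ℝ} (hab : a ≤ b)
    (hf : ∀ x ∈ Icc a b, HasDerivAt f (f' x) x) (hf' : ContinuousOn f' (Icc a b)) :
    ∫ x in Icc a b, f' x = f b - f a := by
  rw [integral_Icc_eq_integral_Ioc, ← intervalIntegral.integral_of_le hab]
  refine intervalIntegral.integral_eq_sub_of_hasDerivAt (by rwa [uIcc_of_le hab]) ?_
  exact ContinuousOn.intervalIntegrable (by rwa [uIcc_of_le hab])

/-- If `∂_τ P + ∂_s A + ∂_t B = 0` on a box and the fluxes of `A` and `B` through the faces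
`s = const` and `t = const` cancel, then the integrals of `P` over the faces `τ = 0` and `τ = 1`
coincide. -/
lemma integral_face_eq_of_divergence_eq_zero {a b c d : ℝ} (hab : a ≤ b) (hcd : c ≤ d)
    {P A B dP dA dB : ℝ → ℝ → ℝ → ℝ}
    (hP : ContinuousOn (fun q : ℝ × ℝ × ℝ => P q.1 q.2.1 q.2.2) (Icc a b ×ˢ Icc c d ×ˢ Icc 0 1))
    (hdP : ContinuousOn (fun q : ℝ × ℝ × ℝ => dP q.1 q.2.1 q.2.2) (Icc a b ×ˢ Icc c d ×ˢ Icc 0 1))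
    (hdA : ContinuousOn (fun q : ℝ × ℝ × ℝ => dA q.1 q.2.1 q.2.2) (Icc a b ×ˢ Icc c d ×ˢ Icc 0 1))
    (hdB : ContinuousOn (fun q : ℝ × ℝ × ℝ => dB q.1 q.2.1 q.2.2) (Icc a b ×ˢ Icc c d ×ˢ Icc 0 1))
    (derivP : ∀ s ∈ Icc a b, ∀ t ∈ Icc c d, ∀ τ ∈ Icc (0 : ℝ) 1,
      HasDerivAt (fun x => P s t x) (dP s t τ) τ)
    (derivA : ∀ s ∈ Icc a b, ∀ t ∈ Icc c d, ∀ τ ∈ Icc (0 : ℝ) 1,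
      HasDerivAt (fun x => A x t τ) (dA s t τ) s)
    (derivB : ∀ s ∈ Icc a b, ∀ t ∈ Icc c d, ∀ τ ∈ Icc (0 : ℝ) 1,
      HasDerivAt (fun x => B s x τ) (dB s t τ) t)
    (hdiv : ∀ s ∈ Icc a b, ∀ t ∈ Icc c d, ∀ τ ∈ Icc (0 : ℝ) 1,
      dP s t τ + dA s t τ + dB s t τ = 0)
    (hA : ∀ t ∈ Icc c d, ∀ τ ∈ Icc (0 : ℝ) 1, A b t τ = A a t τ)
    (hB : ∀ s ∈ Icc a b, ∀ τ ∈ Icc (0 : ℝ) 1, B s d τ = B s c τ) :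
    ∫ s in a..b, ∫ t in c..d, P s t 0 = ∫ s in a..b, ∫ t in c..d, P s t 1 := by
  simp only [intervalIntegral.integral_of_le hab, intervalIntegral.integral_of_le hcd,
    ← integral_Icc_eq_integral_Ioc]
  have h0 : (0 : ℝ) ∈ Icc (0 : ℝ) 1 := by simp
  have h1 : (1 : ℝ) ∈ Icc (0 : ℝ) 1 := by simp
  set μs := (volume : Measure ℝ).restrict (Icc a b) with hμs
  set μt := (volume : Measure ℝ).restrict (Icc c d) with hμt
  set μτ := (volume : Measure ℝ).restrict (Icc (0 : ℝ) 1) with hμτ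
  have iP : Integrable (fun q : ℝ × ℝ × ℝ => dP q.1 q.2.1 q.2.2) (μs.prod (μt.prod μτ)) :=
    integrable_box_of_continuousOn hdP
  have iA : Integrable (fun q : ℝ × ℝ × ℝ => dA q.1 q.2.1 q.2.2) (μs.prod (μt.prod μτ)) :=
    integrable_box_of_continuousOn hdA
  have iB : Integrable (fun q : ℝ × ℝ × ℝ => dB q.1 q.2.1 q.2.2) (μs.prod (μt.prod μτ)) :=
    integrable_box_of_continuousOn hdB
  -- the integrals of `∂_s A` and of `∂_t B` over the box vanish
  have zA : ∫ q, dA q.1 q.2.1 q.2.2 ∂(μs.prod (μt.prod μτ)) = 0 := by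
    rw [integral_prod_symm _ iA, hμt, hμτ, Measure.prod_restrict]
    refine setIntegral_eq_zero_of_forall_eq_zero fun q hq => ?_
    rw [hμs, setIntegral_deriv_eq_sub hab (f := fun x => A x q.1 q.2), hA _ hq.1 _ hq.2, sub_self]
    · exact fun s hs => derivA s hs _ hq.1 _ hq.2
    · exact hdA.comp (f := fun s => (s, q)) (by fun_prop) fun s hs => ⟨hs, hq⟩
  have secB (s : ℝ) (hs : s ∈ Icc a b) :
      ∫ q : ℝ × ℝ, dB s q.1 q.2 ∂(μt.prod μτ) = 0 := by
    have hc : ContinuousOn (fun q : ℝ × ℝ => dB s q.1 q.2) (Icc c d ×ˢ Icc 0 1) :=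
      hdB.comp (f := fun q => (s, q)) (by fun_prop) fun q hq => ⟨hs, hq⟩
    have hi : Integrable (fun q : ℝ × ℝ => dB s q.1 q.2) (μt.prod μτ) := by
      rw [hμt, hμτ, Measure.prod_restrict]
      exact hc.integrableOn_compact (isCompact_Icc.prod isCompact_Icc)
    rw [integral_prod_symm _ hi]
    refine setIntegral_eq_zero_of_forall_eq_zero fun τ hτ => ?_
    rw [hμt, setIntegral_deriv_eq_sub hcd (f := fun x => B s x τ), hB _ hs _ hτ, sub_self]
    · exact fun t ht => derivB s hs t ht τ hτ
    · exact hc.comp (f := fun t => (t, τ)) (by fun_prop) fun t ht => ⟨ht, hτ⟩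
  have zB : ∫ q, dB q.1 q.2.1 q.2.2 ∂(μs.prod (μt.prod μτ)) = 0 := by
    rw [integral_prod _ iB]
    exact setIntegral_eq_zero_of_forall_eq_zero fun s hs => secB s hs
  have zP : ∫ q, dP q.1 q.2.1 q.2.2 ∂(μs.prod (μt.prod μτ)) = 0 := by
    have h : ∫ q, (dP q.1 q.2.1 q.2.2 + dA q.1 q.2.1 q.2.2 + dB q.1 q.2.1 q.2.2)
        ∂(μs.prod (μt.prod μτ)) = 0 := by
      rw [hμs, hμt, hμτ, Measure.prod_restrict, Measure.prod_restrict]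
      exact setIntegral_eq_zero_of_forall_eq_zero fun q hq => hdiv _ hq.1 _ hq.2.1 _ hq.2.2
    have h2 := integral_add (iP.add iA) iB
    have h3 := integral_add iP iA
    simp only [Pi.add_apply] at h2 h3
    linarith
  -- the integral of `∂_τ P` over the box is the difference of the integrals over the two faces
  have hPτ (τ : ℝ) (hτ : τ ∈ Icc (0 : ℝ) 1) :
      Integrable (fun q : ℝ × ℝ => P q.1 q.2 τ) (μs.prod μt) := by
    rw [hμs, hμt, Measure.prod_restrict]
    refine ContinuousOn.integrableOn_compact (isCompact_Icc.prod isCompact_Icc) ?_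
    exact hP.comp (f := fun q : ℝ × ℝ => (q.1, q.2, τ)) (by fun_prop) fun q hq => ⟨hq.1, hq.2, hτ⟩
  have key : ∫ q, dP q.1 q.2.1 q.2.2 ∂(μs.prod (μt.prod μτ))
      = ∫ q : ℝ × ℝ, (P q.1 q.2 1 - P q.1 q.2 0) ∂(μs.prod μt) := by
    rw [integral_prod _ iP, integral_prod (fun q : ℝ × ℝ => P q.1 q.2 1 - P q.1 q.2 0)
      ((hPτ 1 h1).sub (hPτ 0 h0))]
    refine setIntegral_congr_fun measurableSet_Icc fun s hs => ?_
    have hc : ContinuousOn (fun q : ℝ × ℝ => dP s q.1 q.2) (Icc c d ×ˢ Icc 0 1) :=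
      hdP.comp (f := fun q => (s, q)) (by fun_prop) fun q hq => ⟨hs, hq⟩
    have hi : Integrable (fun q : ℝ × ℝ => dP s q.1 q.2) (μt.prod μτ) := by
      rw [hμt, hμτ, Measure.prod_restrict]
      exact hc.integrableOn_compact (isCompact_Icc.prod isCompact_Icc)
    change ∫ q : ℝ × ℝ, dP s q.1 q.2 ∂(μt.prod μτ) = _
    rw [integral_prod _ hi]
    refine setIntegral_congr_fun measurableSet_Icc fun t ht => ?_
    refine setIntegral_deriv_eq_sub zero_le_one (f := fun x => P s t x) ?_ ?_
    · exact fun τ hτ => derivP s hs t ht τ hτ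
    · exact hc.comp (f := fun τ => (t, τ)) (by fun_prop) fun τ hτ => ⟨ht, hτ⟩
  rw [zP, integral_sub (hPτ 1 h1) (hPτ 0 h0), integral_prod _ (hPτ 1 h1),
    integral_prod _ (hPτ 0 h0)] at key
  linarith

/-- A closed `C¹` curve `η` on `[a, b]`, with derivative `η'`. The curve is taken to be
differentiable on the whole line; only the values at `a` and `b` are required to agree, not the
tangents there. -/
structure IsC1Loop (η η' : ℝ → E3) (a b : ℝ) : Prop where
  hasDerivAt : ∀ s, HasDerivAt η (η' s) s
  continuous_deriv : Continuous η'
  closed : η a = η b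

lemma IsC1Loop.continuous {η η' : ℝ → E3} {a b : ℝ} (h : IsC1Loop η η' a b) : Continuous η :=
  continuous_iff_continuousAt.2 fun s => (h.hasDerivAt s).continuousAt

/-- The Gauss integral of two closed `C¹` curves does not change when both curves move along
straight lines without meeting. With `X = η_τ (s) - ζ_τ (t)` this is the closedness of the Gauss
form: `∂_τ ⟨F X, X_s × X_t⟩ + ∂_s ⟨F X, X_t × X_τ⟩ + ∂_t ⟨F X, X_τ × X_s⟩ = 0`. No second
derivatives of the curves enter, because `X_{s t} = 0`. -/
theorem gaussIntegral_eq_of_segments {a b c d : ℝ} (hab : a ≤ b) (hcd : c ≤ d)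
    {η₀ η₀' η₁ η₁' ζ₀ ζ₀' ζ₁ ζ₁' : ℝ → E3}
    (h₀ : IsC1Loop η₀ η₀' a b) (h₁ : IsC1Loop η₁ η₁' a b)
    (k₀ : IsC1Loop ζ₀ ζ₀' c d) (k₁ : IsC1Loop ζ₁ ζ₁' c d)
    (hne : ∀ s ∈ Icc a b, ∀ t ∈ Icc c d, ∀ τ ∈ Icc (0 : ℝ) 1,
      η₀ s - ζ₀ t + τ • ((η₁ s - η₀ s) - (ζ₁ t - ζ₀ t)) ≠ 0) :
    ∫ s in a..b, ∫ t in c..d, inner ℝ (coulomb (η₀ s - ζ₀ t)) (cross (η₀' s) (ζ₀' t)) =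
      ∫ s in a..b, ∫ t in c..d, inner ℝ (coulomb (η₁ s - ζ₁ t)) (cross (η₁' s) (ζ₁' t)) := by
  let X (s t τ : ℝ) : E3 := η₀ s - ζ₀ t + τ • ((η₁ s - η₀ s) - (ζ₁ t - ζ₀ t))
  let Xs (s τ : ℝ) : E3 := η₀' s + τ • (η₁' s - η₀' s)
  let Xt (t τ : ℝ) : E3 := -ζ₀' t - τ • (ζ₁' t - ζ₀' t)
  let Xτ (s t : ℝ) : E3 := (η₁ s - η₀ s) - (ζ₁ t - ζ₀ t)
  have cη₀ := h₀.continuous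
  have cη₁ := h₁.continuous
  have cζ₀ := k₀.continuous
  have cζ₁ := k₁.continuous
  have cη₀' := h₀.continuous_deriv
  have cη₁' := h₁.continuous_deriv
  have cζ₀' := k₀.continuous_deriv
  have cζ₁' := k₁.continuous_deriv
  have dXs (s t τ : ℝ) : HasDerivAt (fun x => X x t τ) (Xs s τ) s := by
    have := ((h₀.hasDerivAt s).sub_const (ζ₀ t)).add
      ((((h₁.hasDerivAt s).sub (h₀.hasDerivAt s)).sub_const (ζ₁ t - ζ₀ t)).const_smul τ)
    exact this
  have dXt (s t τ : ℝ) : HasDerivAt (fun x => X s x τ) (Xt t τ) t := by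
    have := ((k₀.hasDerivAt t).const_sub (η₀ s)).add
      ((((k₁.hasDerivAt t).sub (k₀.hasDerivAt t)).const_sub (η₁ s - η₀ s)).const_smul τ)
    refine this.congr_deriv ?_
    simp only [Xt, smul_neg, sub_eq_add_neg]
  have dXτ (s t τ : ℝ) : HasDerivAt (fun x => X s t x) (Xτ s t) τ :=
    (((hasDerivAt_id τ).smul_const (Xτ s t)).const_add (η₀ s - ζ₀ t)).congr_deriv (one_smul ℝ _)
  have dXτs (s t : ℝ) : HasDerivAt (fun x => Xτ x t) (η₁' s - η₀' s) s :=
    ((h₁.hasDerivAt s).sub (h₀.hasDerivAt s)).sub_const _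
  have dXτt (s t : ℝ) : HasDerivAt (fun x => Xτ s x) (-(ζ₁' t - ζ₀' t)) t :=
    ((k₁.hasDerivAt t).sub (k₀.hasDerivAt t)).const_sub _
  have dXsτ (s τ : ℝ) : HasDerivAt (fun x => Xs s x) (η₁' s - η₀' s) τ :=
    (((hasDerivAt_id τ).smul_const (η₁' s - η₀' s)).const_add (η₀' s)).congr_deriv (one_smul ℝ _)
  have dXtτ (t τ : ℝ) : HasDerivAt (fun x => Xt t x) (-(ζ₁' t - ζ₀' t)) τ :=
    (((hasDerivAt_id τ).smul_const (ζ₁' t - ζ₀' t)).const_sub (-ζ₀' t)).congr_deriv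
      (by rw [one_smul])
  have cX : Continuous fun q : ℝ × ℝ × ℝ => X q.1 q.2.1 q.2.2 := by fun_prop
  have cXs : Continuous fun q : ℝ × ℝ × ℝ => Xs q.1 q.2.2 := by fun_prop
  have cXt : Continuous fun q : ℝ × ℝ × ℝ => Xt q.2.1 q.2.2 := by fun_prop
  have cXτ : Continuous fun q : ℝ × ℝ × ℝ => Xτ q.1 q.2.1 := by fun_prop
  have cα : Continuous fun q : ℝ × ℝ × ℝ => η₁' q.1 - η₀' q.1 := by fun_prop
  have cξ : Continuous fun q : ℝ × ℝ × ℝ => -(ζ₁' q.2.1 - ζ₀' q.2.1) := by fun_prop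
  have hX0 : MapsTo (fun q : ℝ × ℝ × ℝ => X q.1 q.2.1 q.2.2) (Icc a b ×ˢ Icc c d ×ˢ Icc 0 1)
      {x | x ≠ 0} := fun q hq => hne _ hq.1 _ hq.2.1 _ hq.2.2
  have cF : ContinuousOn (fun q : ℝ × ℝ × ℝ => coulomb (X q.1 q.2.1 q.2.2))
      (Icc a b ×ˢ Icc c d ×ˢ Icc 0 1) := continuousOn_coulomb.comp cX.continuousOn hX0
  have cDF {h : ℝ × ℝ × ℝ → E3} (hh : Continuous h) :
      ContinuousOn (fun q : ℝ × ℝ × ℝ => coulombDeriv (X q.1 q.2.1 q.2.2) (h q))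
        (Icc a b ×ˢ Icc c d ×ˢ Icc 0 1) :=
    continuousOn_coulombDeriv.comp (f := fun q : ℝ × ℝ × ℝ => (X q.1 q.2.1 q.2.2, h q))
      (cX.prodMk hh).continuousOn hX0
  have main := integral_face_eq_of_divergence_eq_zero hab hcd
    (P := fun s t τ => inner ℝ (coulomb (X s t τ)) (cross (Xs s τ) (Xt t τ)))
    (A := fun s t τ => inner ℝ (coulomb (X s t τ)) (cross (Xt t τ) (Xτ s t)))
    (B := fun s t τ => inner ℝ (coulomb (X s t τ)) (cross (Xτ s t) (Xs s τ)))
    (dP := fun s t τ => inner ℝ (coulomb (X s t τ))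
        (cross (Xs s τ) (-(ζ₁' t - ζ₀' t)) + cross (η₁' s - η₀' s) (Xt t τ)) +
      inner ℝ (coulombDeriv (X s t τ) (Xτ s t)) (cross (Xs s τ) (Xt t τ)))
    (dA := fun s t τ => inner ℝ (coulomb (X s t τ)) (cross (Xt t τ) (η₁' s - η₀' s)) +
      inner ℝ (coulombDeriv (X s t τ) (Xs s τ)) (cross (Xt t τ) (Xτ s t)))
    (dB := fun s t τ => inner ℝ (coulomb (X s t τ)) (cross (-(ζ₁' t - ζ₀' t)) (Xs s τ)) +
      inner ℝ (coulombDeriv (X s t τ) (Xt t τ)) (cross (Xτ s t) (Xs s τ)))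
    (cF.inner (cXs.cross cXt).continuousOn)
    ((cF.inner ((cXs.cross cξ).add (cα.cross cXt)).continuousOn).add
      ((cDF cXτ).inner (cXs.cross cXt).continuousOn))
    ((cF.inner (cXt.cross cα).continuousOn).add ((cDF cXs).inner (cXt.cross cXτ).continuousOn))
    ((cF.inner (cξ.cross cXs).continuousOn).add ((cDF cXt).inner (cXτ.cross cXs).continuousOn))
    (fun s hs t ht τ hτ => ((dXτ s t τ).coulomb (hne s hs t ht τ hτ)).inner ℝ
      ((dXsτ s τ).cross (dXtτ t τ)))
    (fun s hs t ht τ hτ => by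
      have := ((dXs s t τ).coulomb (hne s hs t ht τ hτ)).inner ℝ
        ((hasDerivAt_const s (Xt t τ)).cross (dXτs s t))
      simpa only [cross_zero_left, add_zero] using this)
    (fun s hs t ht τ hτ => by
      have := ((dXt s t τ).coulomb (hne s hs t ht τ hτ)).inner ℝ
        ((dXτt s t).cross (hasDerivAt_const t (Xs s τ)))
      simpa only [cross_zero_right, zero_add] using this)
    (fun s hs t ht τ hτ => by
      have h := coulombDeriv_alternating (hne s hs t ht τ hτ) (Xτ s t) (Xs s τ) (Xt t τ)
      have e1 := cross_swap (Xt t τ) (η₁' s - η₀' s)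
      have e2 := cross_swap (Xs s τ) (-(ζ₁' t - ζ₀' t))
      simp only [e1, e2, inner_add_right, inner_neg_right]
      simp only [X] at h ⊢
      linarith)
    (fun t ht τ hτ => by simp only [X, Xτ, h₀.closed, h₁.closed])
    (fun s hs τ hτ => by simp only [X, Xτ, k₀.closed, k₁.closed])
  have e0 (s t : ℝ) : inner ℝ (coulomb (X s t 0)) (cross (Xs s 0) (Xt t 0)) =
      -inner ℝ (coulomb (η₀ s - ζ₀ t)) (cross (η₀' s) (ζ₀' t)) := by
    simp only [X, Xs, Xt, zero_smul, add_zero, sub_zero, cross_neg_right, inner_neg_right]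
  have e1 (s t : ℝ) : inner ℝ (coulomb (X s t 1)) (cross (Xs s 1) (Xt t 1)) =
      -inner ℝ (coulomb (η₁ s - ζ₁ t)) (cross (η₁' s) (ζ₁' t)) := by
    have x1 : X s t 1 = η₁ s - ζ₁ t := by simp only [X, one_smul]; abel
    have x2 : Xs s 1 = η₁' s := by simp only [Xs, one_smul]; abel
    have x3 : Xt t 1 = -ζ₁' t := by simp only [Xt, one_smul]; abel
    rw [x1, x2, x3, cross_neg_right, inner_neg_right]
  simp only [e0, e1, intervalIntegral.integral_neg] at main
  linarith

/-! ### The linking number as a homotopy invariant -/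

/-- On `[a, b]` the curve `η` coincides with a closed `C¹` curve; its values elsewhere are
arbitrary. -/
def IsClosedC1On (η : ℝ → E3) (a b : ℝ) : Prop :=
  ∃ η₁ η₁' : ℝ → E3, IsC1Loop η₁ η₁' a b ∧ EqOn η η₁ (Icc a b)

lemma IsC1Loop.isClosedC1On {η η' : ℝ → E3} {a b : ℝ} (h : IsC1Loop η η' a b) :
    IsClosedC1On η a b := ⟨η, η', h, fun _ _ => rfl⟩

lemma IsClosedC1On.continuousOn {η : ℝ → E3} {a b : ℝ} (h : IsClosedC1On η a b) :
    ContinuousOn η (Icc a b) := by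
  obtain ⟨η₁, η₁', h₁, e⟩ := h
  exact h₁.continuous.continuousOn.congr e

lemma linkingNumber_eq_gaussIntegral {a b c d : ℝ} (hab : a ≤ b) (hcd : c ≤ d)
    {η η₁ η₁' ζ ζ₁ ζ₁' : ℝ → E3} (h : IsC1Loop η₁ η₁' a b) (k : IsC1Loop ζ₁ ζ₁' c d)
    (eη : EqOn η η₁ (Icc a b)) (eζ : EqOn ζ ζ₁ (Icc c d)) :
    linkingNumber η a b ζ c d = 1 / (4 * π) *
      ∫ s in a..b, ∫ t in c..d, inner ℝ (coulomb (η₁ s - ζ₁ t)) (cross (η₁' s) (ζ₁' t)) := by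
  have hd {f f₁ f₁' : ℝ → E3} {x y z : ℝ} (hf : IsC1Loop f₁ f₁' x y) (e : EqOn f f₁ (Icc x y))
      (hz : z ∈ Ioo x y) : deriv f z = f₁' z := by
    have : f =ᶠ[𝓝 z] f₁ := e.eventuallyEq_of_mem (Icc_mem_nhds hz.1 hz.2)
    rw [this.deriv_eq, (hf.hasDerivAt z).deriv]
  unfold linkingNumber
  congr 1
  refine intervalIntegral.integral_congr_Ioo_of_le hab fun s hs => ?_
  refine intervalIntegral.integral_congr_Ioo_of_le hcd fun t ht => ?_
  simp only [coulomb, hd h eη hs, hd k eζ ht, eη (Ioo_subset_Icc_self hs),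
    eζ (Ioo_subset_Icc_self ht)]

/-- The linking number does not change when closed `C¹` curves move by less than their distance. -/
theorem linkingNumber_eq_of_close {a b c d : ℝ} (hab : a ≤ b) (hcd : c ≤ d)
    {η₀ η₁ ζ₀ ζ₁ : ℝ → E3} (h₀ : IsClosedC1On η₀ a b) (h₁ : IsClosedC1On η₁ a b)
    (k₀ : IsClosedC1On ζ₀ c d) (k₁ : IsClosedC1On ζ₁ c d)
    (hclose : ∀ s ∈ Icc a b, ∀ t ∈ Icc c d,
      ‖η₁ s - η₀ s‖ + ‖ζ₁ t - ζ₀ t‖ < ‖η₀ s - ζ₀ t‖) :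
    linkingNumber η₀ a b ζ₀ c d = linkingNumber η₁ a b ζ₁ c d := by
  obtain ⟨x₀, x₀', hx₀, ex₀⟩ := h₀
  obtain ⟨x₁, x₁', hx₁, ex₁⟩ := h₁
  obtain ⟨y₀, y₀', hy₀, ey₀⟩ := k₀
  obtain ⟨y₁, y₁', hy₁, ey₁⟩ := k₁
  rw [linkingNumber_eq_gaussIntegral hab hcd hx₀ hy₀ ex₀ ey₀,
    linkingNumber_eq_gaussIntegral hab hcd hx₁ hy₁ ex₁ ey₁]
  congr 1
  refine gaussIntegral_eq_of_segments hab hcd hx₀ hx₁ hy₀ hy₁ fun s hs t ht τ hτ h0 => ?_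
  have hc := hclose s hs t ht
  rw [ex₀ hs, ex₁ hs, ey₀ ht, ey₁ ht, eq_neg_of_add_eq_zero_left h0, norm_neg, norm_smul,
    Real.norm_of_nonneg hτ.1] at hc
  have h1 := norm_sub_le (x₁ s - x₀ s) (y₁ t - y₀ t)
  have h2 := mul_le_mul hτ.2 h1 (norm_nonneg _) zero_le_one
  linarith

lemma linkingNumber_const_left (x : E3) (a b : ℝ) (ζ : ℝ → E3) (c d : ℝ) :
    linkingNumber (fun _ => x) a b ζ c d = 0 := by
  simp [linkingNumber, cross_zero_left]

/-- The average of `g` over `[t, t + h]`. -/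
noncomputable def steklovMean (h : ℝ) (g : ℝ → E3) (t : ℝ) : E3 := h⁻¹ • ∫ x in t..t + h, g x

lemma steklovMean_sub_le {h : ℝ} (hh : 0 < h) {f g : ℝ → E3} (hf : Continuous f)
    (hg : Continuous g) {C : ℝ} {t : ℝ} (hC : ∀ x ∈ Icc t (t + h), ‖f x - g x‖ ≤ C) :
    ‖steklovMean h f t - steklovMean h g t‖ ≤ C := by
  rw [steklovMean, steklovMean, ← smul_sub, ← intervalIntegral.integral_sub
    (hf.intervalIntegrable _ _) (hg.intervalIntegrable _ _), norm_smul, norm_inv,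
    Real.norm_of_nonneg hh.le]
  have := intervalIntegral.norm_integral_le_of_norm_le_const (a := t) (b := t + h)
    (f := fun x => f x - g x) (C := C) fun x hx => by
      rw [uIoc_of_le (by linarith)] at hx
      exact hC x (Ioc_subset_Icc_self hx)
  rw [add_sub_cancel_left, abs_of_pos hh] at this
  rw [inv_mul_le_iff₀ hh, mul_comm]
  exact this

lemma steklovMean_const {h : ℝ} (hh : h ≠ 0) (x : E3) :
    steklovMean h (fun _ => x) = fun _ => x := by
  ext1 t
  simp [steklovMean, smul_smul, hh]

lemma isC1Loop_steklovMean (h : ℝ) {g : ℝ → E3} (hg : Continuous g) {a b : ℝ}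
    (hper : g.Periodic (b - a)) :
    IsC1Loop (steklovMean h g) (fun t => h⁻¹ • (g (t + h) - g t)) a b where
  hasDerivAt t := by
    have key : steklovMean h g
        = fun t => h⁻¹ • ((∫ x in (0 : ℝ)..t + h, g x) - ∫ x in (0 : ℝ)..t, g x) := by
      ext1 t
      rw [steklovMean, intervalIntegral.integral_interval_sub_left
        (hg.intervalIntegrable _ _) (hg.intervalIntegrable _ _)]
    have h1 (u : ℝ) : HasDerivAt (fun t => ∫ x in (0 : ℝ)..t, g x) (g u) u :=
      intervalIntegral.integral_hasDerivAt_right (hg.intervalIntegrable _ _)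
        (hg.stronglyMeasurableAtFilter _ _) hg.continuousAt
    rw [key]
    exact HasDerivAt.fun_const_smul _ (((h1 (t + h)).comp_add_const t h).fun_sub (h1 t))
  continuous_deriv := by fun_prop
  closed := by
    have := intervalIntegral.integral_comp_add_right (a := a) (b := a + h) g (b - a)
    simp only [hper _] at this
    rw [steklovMean, steklovMean, this]
    congr 2 <;> ring

lemma exists_dist_circleExp_lt {ε : ℝ} (hε : 0 < ε) :
    ∃ δ > 0, ∀ x y : ℝ, |x - y| ≤ δ → dist (Circle.exp x) (Circle.exp y) < ε := by
  refine ⟨ε / 2, by positivity, fun x y h => ?_⟩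
  have e : (Circle.exp x : ℂ) - Circle.exp y
      = Circle.exp y * (Complex.exp (Complex.I * (x - y : ℝ)) - 1) := by
    rw [mul_sub, mul_one, Circle.coe_exp, Circle.coe_exp, ← Complex.exp_add]
    congr 2
    push_cast
    ring
  change dist (Circle.exp x : ℂ) (Circle.exp y) < ε
  rw [dist_eq_norm, e, norm_mul, Circle.norm_coe, one_mul]
  exact lt_of_le_of_lt (Real.norm_exp_I_mul_ofReal_sub_one_le.trans h) (by linarith)

/-- A closed `C¹` curve that can be contracted, through continuous loops, in the complement of a
closed `C¹` curve has linking number zero with it. The slices of the contraction are merely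
continuous, so their linking numbers are defined through Steklov means; these vary with the
parameter of the contraction in a locally constant way. -/
theorem linkingNumber_eq_zero_of_contraction {G : unitInterval × Circle → E3} (hG : Continuous G)
    {c d : ℝ} (hcd : c ≤ d) {ζ : ℝ → E3} (hζ : IsClosedC1On ζ c d)
    (hne : ∀ q, ∀ t ∈ Icc c d, G q ≠ ζ t)
    (hγ : IsClosedC1On (fun t => G (0, Circle.exp t)) 0 (2 * π))
    {y : E3} (hy : ∀ x, G (1, x) = y) :
    linkingNumber (fun t => G (0, Circle.exp t)) 0 (2 * π) ζ c d = 0 := by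
  have hπ : (0 : ℝ) ≤ 2 * π := by positivity
  -- by compactness, the trace of the homotopy keeps a positive distance `δ` from the curve `ζ`
  obtain ⟨δ, hδ, hδG⟩ : ∃ δ > 0, ∀ q, ∀ t ∈ Icc c d, δ ≤ ‖G q - ζ t‖ := by
    have hc : ContinuousOn (fun x : (unitInterval × Circle) × ℝ => ‖G x.1 - ζ x.2‖)
        (univ ×ˢ Icc c d) :=
      ((hG.comp continuous_fst).continuousOn.sub
        (hζ.continuousOn.comp continuousOn_snd fun x hx => hx.2)).norm
    have hcpt : IsCompact ((univ : Set (unitInterval × Circle)) ×ˢ Icc c d) :=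
      isCompact_univ.prod isCompact_Icc
    have hnon : ((univ : Set (unitInterval × Circle)) ×ˢ Icc c d).Nonempty :=
      univ_nonempty.prod (nonempty_Icc.2 hcd)
    obtain ⟨x, hx, hmin⟩ := hcpt.exists_isMinOn hnon hc
    refine ⟨‖G x.1 - ζ x.2‖, norm_pos_iff.2 (sub_ne_zero.2 (hne x.1 x.2 hx.2)), fun q t ht => ?_⟩
    exact isMinOn_iff.1 hmin (q, t) ⟨mem_univ _, ht⟩
  obtain ⟨ρ, hρ, hρG⟩ := Metric.uniformContinuous_iff.1
    (CompactSpace.uniformContinuous_of_continuous hG) (δ / 4) (by positivity)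
  obtain ⟨h, hh, hexp⟩ := exists_dist_circleExp_lt hρ
  let g (τ : unitInterval) (t : ℝ) : E3 := G (τ, Circle.exp t)
  have hg (τ : unitInterval) : Continuous (g τ) :=
    hG.comp (continuous_const.prodMk Circle.exp.continuous)
  have hloop (τ : unitInterval) : IsClosedC1On (steklovMean h (g τ)) 0 (2 * π) := by
    refine (isC1Loop_steklovMean h (hg τ) fun t => ?_).isClosedC1On
    simp only [g, sub_zero, Circle.exp_add, Circle.exp_two_pi, mul_one]
  have hmean (τ : unitInterval) (t : ℝ) : ‖steklovMean h (g τ) t - g τ t‖ ≤ δ / 4 := by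
    have := steklovMean_sub_le hh (hg τ) (continuous_const (y := g τ t)) (t := t) (C := δ / 4)
      fun x hx => by
        rw [← dist_eq_norm]
        refine (hρG ?_).le
        rw [Prod.dist_eq, dist_self, max_eq_right dist_nonneg]
        refine hexp _ _ ?_
        rw [abs_of_nonneg] <;> linarith [hx.1, hx.2]
    rwa [steklovMean_const hh.ne'] at this
  have hsep (τ : unitInterval) (s : ℝ) (t : ℝ) (ht : t ∈ Icc c d) : δ ≤ ‖g τ s - ζ t‖ :=
    hδG _ t ht
  let f (τ : unitInterval) : ℝ := linkingNumber (steklovMean h (g τ)) 0 (2 * π) ζ c d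
  have hf : IsLocallyConstant f := by
    refine (IsLocallyConstant.iff_eventually_eq f).2 fun τ => ?_
    filter_upwards [Metric.ball_mem_nhds τ hρ] with τ' hτ'
    refine (linkingNumber_eq_of_close hπ hcd (hloop τ) (hloop τ') hζ hζ fun s _ t ht => ?_).symm
    have h1 : ‖steklovMean h (g τ') s - steklovMean h (g τ) s‖ ≤ δ / 4 := by
      refine steklovMean_sub_le hh (hg τ') (hg τ) fun x _ => ?_
      rw [← dist_eq_norm]
      refine (hρG ?_).le
      rw [Prod.dist_eq, dist_self, max_eq_left dist_nonneg]
      exact hτ'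
    have h2 := hsep τ s t ht
    have h3 := norm_sub_norm_le (g τ s - ζ t) (g τ s - steklovMean h (g τ) s)
    rw [sub_sub_sub_cancel_left, norm_sub_rev (g τ s) (steklovMean h (g τ) s)] at h3
    have h4 := hmean τ s
    rw [sub_self, norm_zero]
    linarith
  have h0 : f 0 = linkingNumber (g 0) 0 (2 * π) ζ c d := by
    refine (linkingNumber_eq_of_close hπ hcd hγ (hloop 0) hζ hζ fun s _ t ht => ?_).symm
    have h2 := hsep 0 s t ht
    have h4 := hmean 0 s
    rw [sub_self, norm_zero]
    change ‖steklovMean h (g 0) s - g 0 s‖ + 0 < ‖g 0 s - ζ t‖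
    linarith
  have h1 : f 1 = 0 := by
    have e : g 1 = fun _ => y := funext fun s => hy _
    simp only [f, e, steklovMean_const hh.ne', linkingNumber_const_left]
  exact h0.symm.trans ((hf.apply_eq_of_preconnectedSpace 0 1).trans h1)

/-- A `C¹` loop whose linking number with a closed curve contained in `K` does not vanish cannot be
contracted in the complement of `K`. -/
theorem not_nullhomotopic_of_linkingNumber_ne_zero {K : Set E3} (γ : C(Circle, ↥Kᶜ))
    {c d : ℝ} (hcd : c ≤ d) {ζ : ℝ → E3} (hζ : IsClosedC1On ζ c d) (hζK : ζ '' Icc c d ⊆ K)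
    (hγ : IsClosedC1On (fun t => (γ (Circle.exp t) : E3)) 0 (2 * π))
    (hl : linkingNumber (fun t => (γ (Circle.exp t) : E3)) 0 (2 * π) ζ c d ≠ 0) :
    ¬ γ.Nullhomotopic := by
  rintro ⟨y, ⟨F⟩⟩
  have e (x : Circle) : (F (0, x) : E3) = γ x := by rw [F.apply_zero]
  simp only [← e] at hγ hl
  refine hl (linkingNumber_eq_zero_of_contraction (G := fun q => (F q : E3))
    (continuous_subtype_val.comp F.continuous) hcd hζ (fun q t ht h => (F q).2 ?_) hγ (y := y) ?_)
  · exact hζK ⟨t, ht, h.symm⟩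
  · intro x
    rw [F.apply_one, ContinuousMap.const_apply]

/-! ### Area of a set that meets all small translates of a loop -/

lemma exists_circleExp_eq (θ : Circle) : ∃ t ∈ Icc 0 (2 * π), Circle.exp t = θ := by
  obtain ⟨t, rfl⟩ := Circle.exp_surjective θ
  obtain ⟨s, hs, e⟩ := Circle.periodic_exp.exists_mem_Ico₀ Real.two_pi_pos t
  exact ⟨s, Ico_subset_Icc_self hs, e.symm⟩

/-- The constant relating area to the volume swept out by a loop with Lipschitz constant `K`. -/
noncomputable def sweepConst (K : ℝ) : ℝ :=
  (2 * π * K + 1) * 8 * (volume (Metric.ball (0 : E3) 1)).toReal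

lemma sweepConst_pos {K : ℝ} (hK : 0 < K) : 0 < sweepConst K := by
  have : 0 < (volume (Metric.ball (0 : E3) 1)).toReal :=
    ENNReal.toReal_pos (Metric.measure_ball_pos _ _ one_pos).ne' measure_ball_lt_top.ne
  have := Real.pi_pos
  unfold sweepConst
  positivity

/-- A tube of radius `d ≤ 1` about a translate of `-γ` has volume of order `d²`. -/
lemma volume_tube_le {γ : Circle → E3} {K : ℝ} (hK : 0 < K)
    (hγ : ∀ s t : ℝ, ‖γ (Circle.exp s) - γ (Circle.exp t)‖ ≤ K * |s - t|) (x : E3) {d : ℝ}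
    (hd : 0 < d) (hd1 : d ≤ 1) :
    volume {y : E3 | ∃ θ, ‖y - (x - γ θ)‖ ≤ d} ≤ ENNReal.ofReal (sweepConst K * d ^ 2) := by
  set h := d / K with hh
  have hh0 : 0 < h := by positivity
  set N := ⌊2 * π / h⌋₊
  have hcov : {y : E3 | ∃ θ, ‖y - (x - γ θ)‖ ≤ d} ⊆
      ⋃ j ∈ Finset.range (N + 1), Metric.closedBall (x - γ (Circle.exp (j * h))) (2 * d) := by
    rintro y ⟨θ, hy⟩
    obtain ⟨t, ht, rfl⟩ := exists_circleExp_eq θ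
    have hj : ⌊t / h⌋₊ ∈ Finset.range (N + 1) :=
      Finset.mem_range_succ_iff.2 (Nat.floor_le_floor (by gcongr; exact ht.2))
    refine mem_biUnion hj ?_
    have h1 : (⌊t / h⌋₊ : ℝ) * h ≤ t := by
      rw [← le_div_iff₀ hh0]; exact Nat.floor_le (div_nonneg ht.1 hh0.le)
    have h2 : t < ((⌊t / h⌋₊ : ℝ) + 1) * h := by
      rw [← div_lt_iff₀ hh0]; exact Nat.lt_floor_add_one _
    have h3 := hγ (⌊t / h⌋₊ * h) t
    have h4 : K * |⌊t / h⌋₊ * h - t| ≤ d := by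
      have : |⌊t / h⌋₊ * h - t| ≤ h := by rw [abs_sub_comm, abs_of_nonneg] <;> linarith
      calc K * |⌊t / h⌋₊ * h - t| ≤ K * h := by gcongr
        _ = d := by rw [hh]; field_simp
    rw [mem_closedBall_iff_norm]
    have h5 : y - (x - γ (Circle.exp (⌊t / h⌋₊ * h))) =
      (y - (x - γ (Circle.exp t))) + (γ (Circle.exp (⌊t / h⌋₊ * h)) - γ (Circle.exp t)) := by abel
    rw [h5]
    exact (norm_add_le _ _).trans (by linarith)
  have hv : volume (Metric.ball (0 : E3) 1) ≠ ⊤ := measure_ball_lt_top.ne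
  have hN : ((N : ℝ) + 1) * (2 * d) ^ 3 * (volume (Metric.ball (0 : E3) 1)).toReal
      ≤ sweepConst K * d ^ 2 := by
    have h1 : (N : ℝ) ≤ 2 * π / h := Nat.floor_le (by positivity)
    have h2 : ((N : ℝ) + 1) * d ≤ 2 * π * K + 1 := by
      have h3 : 2 * π / h * d = 2 * π * K := by rw [hh]; field_simp
      nlinarith
    calc ((N : ℝ) + 1) * (2 * d) ^ 3 * (volume (Metric.ball (0 : E3) 1)).toReal
        = ((N : ℝ) + 1) * d * (8 * d ^ 2 * (volume (Metric.ball (0 : E3) 1)).toReal) := by ring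
      _ ≤ (2 * π * K + 1) * (8 * d ^ 2 * (volume (Metric.ball (0 : E3) 1)).toReal) := by gcongr
      _ = sweepConst K * d ^ 2 := by rw [sweepConst]; ring
  calc volume {y : E3 | ∃ θ, ‖y - (x - γ θ)‖ ≤ d}
      ≤ ∑ j ∈ Finset.range (N + 1),
          volume (Metric.closedBall (x - γ (Circle.exp (j * h))) (2 * d)) :=
        (measure_mono hcov).trans (measure_biUnion_finset_le _ _)
    _ = (N + 1 : ℕ) * (ENNReal.ofReal ((2 * d) ^ 3) * volume (Metric.ball (0 : E3) 1)) := by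
        simp only [Measure.addHaar_closedBall _ _ (by positivity : 0 ≤ 2 * d),
          finrank_euclideanSpace_fin, Finset.sum_const, Finset.card_range, nsmul_eq_mul]
    _ = ENNReal.ofReal (((N : ℝ) + 1) * (2 * d) ^ 3 *
          (volume (Metric.ball (0 : E3) 1)).toReal) := by
        rw [ENNReal.ofReal_mul (by positivity), ENNReal.ofReal_mul (by positivity),
          ENNReal.ofReal_toReal hv, mul_assoc]
        norm_cast
    _ ≤ _ := ENNReal.ofReal_le_ofReal hN

/-- The volume of `{x - γ θ | x ∈ A}` is at most a constant times the squared diameter of `A`. -/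
lemma volume_sweep_le {γ : Circle → E3} {K : ℝ} (hK : 0 < K)
    (hγ : ∀ s t : ℝ, ‖γ (Circle.exp s) - γ (Circle.exp t)‖ ≤ K * |s - t|) {A : Set E3}
    (hA : Metric.ediam A ≤ 1) :
    volume {y : E3 | ∃ x ∈ A, ∃ θ, y = x - γ θ} ≤
      ENNReal.ofReal (sweepConst K) * ⨆ _ : A.Nonempty, Metric.ediam A ^ (2 : ℝ) := by
  rcases A.eq_empty_or_nonempty with rfl | hne
  · simp
  rw [ciSup_pos hne]
  obtain ⟨x₀, hx₀⟩ := hne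
  have hfin : Metric.ediam A ≠ ⊤ := ne_top_of_le_ne_top ENNReal.one_ne_top hA
  have hdiam : (Metric.ediam A).toReal ≤ 1 := ENNReal.toReal_le_of_le_ofReal zero_le_one (by simpa)
  have key {d : ℝ} (h0 : 0 < d) (h1 : d ≤ 1) (hd : (Metric.ediam A).toReal ≤ d) :
      volume {y : E3 | ∃ x ∈ A, ∃ θ, y = x - γ θ} ≤ ENNReal.ofReal (sweepConst K * d ^ 2) := by
    refine (measure_mono ?_).trans (volume_tube_le hK hγ x₀ h0 h1)
    rintro y ⟨x, hx, θ, rfl⟩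
    refine ⟨θ, ?_⟩
    rw [sub_sub_sub_cancel_right, ← dist_eq_norm]
    refine le_trans ?_ hd
    rw [dist_edist]
    exact ENNReal.toReal_mono hfin (Metric.edist_le_ediam_of_mem hx hx₀)
  rcases (ENNReal.toReal_nonneg (a := Metric.ediam A)).eq_or_lt with h0 | h0
  · -- a point sweeps out a curve, which has volume zero
    have hlim : Tendsto (fun n : ℕ => ENNReal.ofReal (sweepConst K * (1 / ((n : ℝ) + 1)) ^ 2)) atTop
        (𝓝 0) := by
      have h1 := (tendsto_one_div_add_atTop_nhds_zero_nat (𝕜 := ℝ)).pow 2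
        |>.const_mul (sweepConst K)
      simpa using ENNReal.tendsto_ofReal h1
    refine le_trans (ge_of_tendsto' hlim fun n => key (by positivity) ?_ ?_) zero_le
    · rw [div_le_one (by positivity)]; linarith [(n.cast_nonneg : (0 : ℝ) ≤ n)]
    · rw [← h0]; positivity
  · refine (key h0 hdiam le_rfl).trans_eq ?_
    rw [ENNReal.ofReal_mul (sweepConst_pos hK).le, ENNReal.ofReal_pow h0.le,
      ENNReal.ofReal_toReal hfin, ENNReal.rpow_two]

/-- If `S` meets every translate `γ + a` with `|a| < ε`, then the area of the part of `S` in the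
tube of radius `ε` about `γ` is bounded below by a multiple of the volume of the `ε`-ball: a small
piece `A` of `S` meets only the translates by vectors `a ∈ A - γ`, and these fill a volume of order
`(diam A)²`. -/
theorem le_hausdorffMeasure_of_meets_translates {γ : Circle → E3} {K : ℝ} (hK : 0 < K)
    (hγ : ∀ s t : ℝ, ‖γ (Circle.exp s) - γ (Circle.exp t)‖ ≤ K * |s - t|) {S : Set E3} {ε : ℝ}
    (hS : ∀ a : E3, ‖a‖ < ε → ∃ θ, γ θ + a ∈ S) :
    ENNReal.ofReal ((volume (Metric.ball (0 : E3) ε)).toReal / sweepConst K)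
      ≤ μH[2] (S ∩ tube γ ε) := by
  rw [Measure.hausdorffMeasure_apply]
  refine le_iSup₂_of_le 1 one_pos (le_iInf₂ fun t ht => le_iInf fun hdiam => ?_)
  have hC := sweepConst_pos hK
  rw [ENNReal.ofReal_div_of_pos hC, ENNReal.ofReal_toReal measure_ball_lt_top.ne]
  refine ENNReal.div_le_of_le_mul' ?_
  rw [← ENNReal.tsum_mul_left]
  calc volume (Metric.ball (0 : E3) ε)
      ≤ volume (⋃ n, {y : E3 | ∃ x ∈ t n, ∃ θ, y = x - γ θ}) := by
        refine measure_mono fun a ha => ?_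
        rw [mem_ball_zero_iff] at ha
        obtain ⟨θ, hθ⟩ := hS a ha
        have : γ θ + a ∈ S ∩ tube γ ε := by
          refine ⟨hθ, Metric.mem_thickening_iff.2 ⟨γ θ, mem_range_self _, ?_⟩⟩
          rwa [dist_eq_norm, add_sub_cancel_left]
        obtain ⟨n, hn⟩ := mem_iUnion.1 (ht this)
        exact mem_iUnion.2 ⟨n, γ θ + a, hn, θ, (add_sub_cancel_left _ _).symm⟩
    _ ≤ ∑' n, volume {y : E3 | ∃ x ∈ t n, ∃ θ, y = x - γ θ} := measure_iUnion_le _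
    _ ≤ _ := ENNReal.tsum_le_tsum fun n => volume_sweep_le hK hγ (hdiam n)

/-! ### Smooth loops have tubular neighbourhoods -/

lemma _root_.Function.Periodic.deriv {f : ℝ → E3} {T : ℝ} (hf : f.Periodic T) :
    (deriv f).Periodic T := fun t => by
  rw [← deriv_comp_add_const]
  congr 1
  exact funext hf

lemma _root_.Function.Periodic.exists_norm_le {f : ℝ → E3} (hper : f.Periodic (2 * π))
    (hf : Continuous f) : ∃ C > 0, ∀ t, ‖f t‖ ≤ C := by
  obtain ⟨C, hC⟩ := (isCompact_Icc (a := (0 : ℝ)) (b := 2 * π)).exists_bound_of_continuousOn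
    hf.continuousOn
  refine ⟨max C 1, by positivity, fun t => ?_⟩
  obtain ⟨s, hs, e⟩ := hper.exists_mem_Ico₀ Real.two_pi_pos t
  rw [e]
  exact (hC s (Ico_subset_Icc_self hs)).trans (le_max_left _ _)

lemma periodic_comp_circleExp (γ : Circle → E3) :
    (fun t : ℝ => γ (Circle.exp t)).Periodic (2 * π) := fun t => by
  simp only [Circle.periodic_exp t]

lemma range_eq_image_circleExp (γ : Circle → E3) :
    range γ = (fun t : ℝ => γ (Circle.exp t)) '' Icc 0 (2 * π) := by
  ext x
  constructor
  · rintro ⟨θ, rfl⟩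
    obtain ⟨t, ht, rfl⟩ := exists_circleExp_eq θ
    exact ⟨t, ht, rfl⟩
  · rintro ⟨t, -, rfl⟩
    exact mem_range_self _

lemma IsSmoothLoop.isCompact_range {γ : Circle → E3} (h : IsSmoothLoop γ) :
    IsCompact (range γ) := by
  rw [range_eq_image_circleExp]
  exact isCompact_Icc.image h.contDiff.continuous

lemma IsSmoothLoop.differentiable {γ : Circle → E3} (h : IsSmoothLoop γ) :
    Differentiable ℝ fun t : ℝ => γ (Circle.exp t) := h.contDiff.differentiable (by simp)

lemma IsSmoothLoop.contDiff_deriv {γ : Circle → E3} (h : IsSmoothLoop γ) :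
    ContDiff ℝ ∞ (deriv fun t : ℝ => γ (Circle.exp t)) :=
  (contDiff_infty_iff_deriv.1 h.contDiff).2

lemma IsSmoothLoop.isC1Loop {γ : Circle → E3} (h : IsSmoothLoop γ) :
    IsC1Loop (fun t : ℝ => γ (Circle.exp t)) (deriv fun t : ℝ => γ (Circle.exp t)) 0 (2 * π) where
  hasDerivAt t := (h.differentiable t).hasDerivAt
  continuous_deriv := h.contDiff_deriv.continuous
  closed := by simp only [Circle.exp_zero, Circle.exp_two_pi]

lemma IsSmoothLoop.exists_lipschitz {γ : Circle → E3} (h : IsSmoothLoop γ) :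
    ∃ K > 0, ∀ s t : ℝ, ‖γ (Circle.exp s) - γ (Circle.exp t)‖ ≤ K * |s - t| := by
  obtain ⟨K, hK, hb⟩ := (periodic_comp_circleExp γ).deriv.exists_norm_le
    h.contDiff_deriv.continuous
  refine ⟨K, hK, fun s t => ?_⟩
  exact convex_univ.norm_image_sub_le_of_norm_deriv_le (fun x _ => h.differentiable x)
    (fun x _ => hb x) (mem_univ t) (mem_univ s)

/-- Points of a smooth loop that are close in space have close parameters. -/
lemma IsSmoothLoop.exists_param_close {γ : Circle → E3} (h : IsSmoothLoop γ) {δ : ℝ} (hδ : 0 < δ) :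
    ∃ η > 0, ∀ s ∈ Icc 0 (2 * π), ∀ t ∈ Icc (s - π) (s + π),
      ‖γ (Circle.exp s) - γ (Circle.exp t)‖ < η → |s - t| < δ := by
  let T : Set (ℝ × ℝ) := {q | q.1 ∈ Icc 0 (2 * π) ∧ q.2 ∈ Icc (-π) (3 * π) ∧
    |q.1 - q.2| ≤ π ∧ δ ≤ |q.1 - q.2|}
  have hT : IsCompact T := by
    have e : T = (Icc 0 (2 * π) ×ˢ Icc (-π) (3 * π)) ∩
        ({q : ℝ × ℝ | |q.1 - q.2| ≤ π} ∩ {q : ℝ × ℝ | δ ≤ |q.1 - q.2|}) := by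
      ext q
      simp only [T, mem_ofPred_eq, mem_inter_iff, mem_prod, and_assoc]
    rw [e]
    refine (isCompact_Icc.prod isCompact_Icc).inter_right (IsClosed.inter ?_ ?_)
    · exact isClosed_le (by fun_prop) continuous_const
    · exact isClosed_le continuous_const (by fun_prop)
  have hpos : ∀ q ∈ T, 0 < ‖γ (Circle.exp q.1) - γ (Circle.exp q.2)‖ := by
    rintro ⟨s, t⟩ ⟨-, -, h1, h2⟩
    refine norm_pos_iff.2 (sub_ne_zero.2 fun e => ?_)
    obtain ⟨m, hm⟩ := Circle.exp_eq_exp.1 (h.injective e)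
    have e2 : s - t = m * (2 * π) := by simp only at hm; linarith
    simp only [e2] at h1 h2
    rw [abs_mul, abs_of_pos Real.two_pi_pos] at h1 h2
    have hm0 : m ≠ 0 := by
      rintro rfl
      simp only [Int.cast_zero, abs_zero, zero_mul] at h2
      linarith
    have hm1 : (1 : ℝ) ≤ |(m : ℝ)| := by exact_mod_cast Int.one_le_abs hm0
    nlinarith [Real.pi_pos]
  have hc : Continuous fun q : ℝ × ℝ => ‖γ (Circle.exp q.1) - γ (Circle.exp q.2)‖ :=
    ((h.contDiff.continuous.comp continuous_fst).sub
      (h.contDiff.continuous.comp continuous_snd)).norm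
  have hmem {s t : ℝ} (hs : s ∈ Icc 0 (2 * π)) (ht : t ∈ Icc (s - π) (s + π))
      (hst : δ ≤ |s - t|) : (s, t) ∈ T := by
    refine ⟨hs, ⟨?_, ?_⟩, ?_, hst⟩
    · linarith [hs.1, ht.1]
    · linarith [hs.2, ht.2]
    · exact abs_le.2 ⟨by linarith [ht.2], by linarith [ht.1]⟩
  rcases T.eq_empty_or_nonempty with hT0 | hT0
  · refine ⟨1, one_pos, fun s hs t ht _ => ?_⟩
    by_contra! hst
    have := hmem hs ht hst
    rw [hT0] at this
    exact this
  · obtain ⟨q, hq, hmin⟩ := hT.exists_isMinOn hT0 hc.continuousOn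
    refine ⟨_, hpos q hq, fun s hs t ht hst => ?_⟩
    by_contra! hst'
    exact absurd (isMinOn_iff.1 hmin (s, t) (hmem hs ht hst')) (not_le.2 hst)

/-- A smooth loop has positive reach. Two nearest points of a point close to the loop have close
parameters, because the loop is embedded; between them the second derivative of the squared
distance is positive, because the loop is immersed, so that its first derivative cannot vanish at
both. -/
theorem IsSmoothLoop.exists_isTubular {γ : Circle → E3} (h : IsSmoothLoop γ) :
    ∃ r > 0, ∀ ε ≤ r, IsTubular γ ε := by
  set c : ℝ → E3 := fun t => γ (Circle.exp t) with hc
  have hper : c.Periodic (2 * π) := periodic_comp_circleExp γ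
  have dc (t : ℝ) : HasDerivAt c (deriv c t) t := (h.differentiable t).hasDerivAt
  have hc2 : ContDiff ℝ ∞ (deriv c) := h.contDiff_deriv
  have ddc (t : ℝ) : HasDerivAt (deriv c) (deriv (deriv c) t) t :=
    (hc2.differentiable (by simp) t).hasDerivAt
  obtain ⟨K, hK, hlip⟩ := h.exists_lipschitz
  obtain ⟨B, hB, hbound⟩ := hper.deriv.deriv.exists_norm_le
    (contDiff_infty_iff_deriv.1 hc2).2.continuous
  -- a lower bound `m` for the squared speed
  obtain ⟨m, hm, hspeed⟩ : ∃ m > 0, ∀ t, m ≤ ‖deriv c t‖ ^ 2 := by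
    obtain ⟨t₀, -, hmin⟩ := (isCompact_Icc (a := (0 : ℝ)) (b := 2 * π)).exists_isMinOn
      (nonempty_Icc.2 Real.two_pi_pos.le) (hc2.continuous.norm.pow 2).continuousOn
    refine ⟨‖deriv c t₀‖ ^ 2, pow_pos (norm_pos_iff.2 (h.deriv_ne_zero t₀)) 2, fun t => ?_⟩
    obtain ⟨s, hs, e⟩ := hper.deriv.exists_mem_Ico₀ Real.two_pi_pos t
    rw [e]
    exact isMinOn_iff.1 hmin s (Ico_subset_Icc_self hs)
  have hδ : 0 < m / (4 * B * K) := by positivity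
  obtain ⟨η, hη, hclose⟩ := h.exists_param_close hδ
  refine ⟨min (η / 2) (m / (4 * B)), by positivity, fun ε hε x hx => ?_⟩
  obtain ⟨y, hy, hxy⟩ := h.isCompact_range.exists_infDist_eq_dist (range_nonempty γ) x
  refine ⟨y, ⟨hy, hxy.symm⟩, ?_⟩
  rintro y' ⟨hy', hxy'⟩
  have hlt : Metric.infDist x (range γ) < min (η / 2) (m / (4 * B)) :=
    (Metric.mem_thickening_iff_infDist_lt (range_nonempty γ)).1 hx |>.trans_le hε
  obtain ⟨θ, rfl⟩ := hy
  obtain ⟨θ', rfl⟩ := hy'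
  obtain ⟨s, hs, rfl⟩ := exists_circleExp_eq θ
  obtain ⟨t, ht, rfl⟩ : ∃ t ∈ Icc (s - π) (s + π), Circle.exp t = θ' := by
    obtain ⟨t, rfl⟩ := Circle.exp_surjective θ'
    obtain ⟨u, hu, e⟩ := Circle.periodic_exp.exists_mem_Ico Real.two_pi_pos t (s - π)
    exact ⟨u, ⟨hu.1, by linarith [hu.2]⟩, e.symm⟩
  by_contra hne
  have hst0 : s ≠ t := by rintro rfl; exact hne rfl
  have hst : |s - t| < m / (4 * B * K) := by
    refine hclose s hs t ht ?_
    rw [← dist_eq_norm]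
    have := dist_triangle_left (γ (Circle.exp s)) (γ (Circle.exp t)) x
    have := hlt.trans_le (min_le_left _ _)
    linarith
  let f (u : ℝ) : ℝ := ‖x - c u‖ ^ 2
  have df (u : ℝ) : HasDerivAt f (2 * inner ℝ (x - c u) (-deriv c u)) u :=
    ((dc u).const_sub x).norm_sq
  have ddf (u : ℝ) : HasDerivAt (fun u => 2 * inner ℝ (x - c u) (-deriv c u))
      (2 * (inner ℝ (x - c u) (-deriv (deriv c) u) + inner ℝ (-deriv c u) (-deriv c u))) u :=
    (((dc u).const_sub x).inner ℝ (ddc u).neg).const_mul 2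
  have hmin (u v : ℝ) (hu : dist x (c u) = Metric.infDist x (range γ)) : f u ≤ f v := by
    simp only [f, ← dist_eq_norm, hu]
    gcongr
    · exact Metric.infDist_nonneg
    · exact Metric.infDist_le_dist_of_mem (mem_range_self _)
  have hs0 : 2 * inner ℝ (x - c s) (-deriv c s) = 0 :=
    IsLocalMin.hasDerivAt_eq_zero (Eventually.of_forall fun v => hmin s v hxy.symm) (df s)
  have ht0 : 2 * inner ℝ (x - c t) (-deriv c t) = 0 :=
    IsLocalMin.hasDerivAt_eq_zero (Eventually.of_forall fun v => hmin t v hxy') (df t)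
  obtain ⟨u, hu, hu0⟩ : ∃ u, |s - u| ≤ |s - t| ∧
      2 * (inner ℝ (x - c u) (-deriv (deriv c) u) + inner ℝ (-deriv c u) (-deriv c u)) = 0 := by
    rcases hst0.lt_or_gt with hlt' | hlt'
    · obtain ⟨u, hu, hu0⟩ := exists_hasDerivAt_eq_zero hlt'
        (fun v _ => (ddf v).continuousAt.continuousWithinAt) (hs0.trans ht0.symm)
        (fun v _ => ddf v)
      refine ⟨u, ?_, hu0⟩
      rw [abs_sub_comm s u, abs_sub_comm s t, abs_of_pos, abs_of_pos] <;> linarith [hu.1, hu.2]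
    · obtain ⟨u, hu, hu0⟩ := exists_hasDerivAt_eq_zero hlt'
        (fun v _ => (ddf v).continuousAt.continuousWithinAt) (ht0.trans hs0.symm)
        (fun v _ => ddf v)
      refine ⟨u, ?_, hu0⟩
      rw [abs_of_pos, abs_of_pos] <;> linarith [hu.1, hu.2]
  have h1 : ‖x - c u‖ ≤ m / (4 * B) + m / (4 * B) := by
    have e : x - c u = (x - c s) + (c s - c u) := by abel
    have h2 : ‖x - c s‖ ≤ m / (4 * B) := by
      rw [← dist_eq_norm]
      exact hxy.symm.le.trans (hlt.le.trans (min_le_right _ _))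
    have h3 : ‖c s - c u‖ ≤ m / (4 * B) := by
      refine (hlip s u).trans ?_
      calc K * |s - u| ≤ K * (m / (4 * B * K)) := by gcongr; exact hu.trans hst.le
        _ = m / (4 * B) := by field_simp
    rw [e]
    exact (norm_add_le _ _).trans (add_le_add h2 h3)
  have h2 : |inner ℝ (x - c u) (deriv (deriv c) u)| ≤ m / 2 := by
    refine (abs_real_inner_le_norm _ _).trans ?_
    calc ‖x - c u‖ * ‖deriv (deriv c) u‖ ≤ (m / (4 * B) + m / (4 * B)) * B := by
          gcongr
          exact hbound u
      _ = m / 2 := by field_simp; ring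
  rw [inner_neg_right, inner_neg_neg, real_inner_self_eq_norm_sq] at hu0
  have h3 := hspeed u
  have h4 := le_abs_self (inner ℝ (x - c u) (deriv (deriv c) u))
  linarith

/-! ### The director equations: a priori bound and Gronwall estimate -/

lemma absolutelyContinuousOnInterval_norm_sq {f : ℝ → E3} {L : ℝ} (x : E3)
    (hf : IntervalIntegrable f volume 0 L) :
    AbsolutelyContinuousOnInterval (fun s => ‖x + ∫ t in (0 : ℝ)..s, f t‖ ^ 2) 0 L := by
  have hi (i : Fin 3) : AbsolutelyContinuousOnInterval
      (fun s => x i + ∫ t in (0 : ℝ)..s, f t i) 0 L := by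
    have h1 : IntervalIntegrable (fun t => f t i) volume 0 L :=
      ⟨(EuclideanSpace.proj (𝕜 := ℝ) i).integrable_comp hf.1,
        (EuclideanSpace.proj (𝕜 := ℝ) i).integrable_comp hf.2⟩
    have h2 : AbsolutelyContinuousOnInterval (fun _ : ℝ => x i) 0 L :=
      LipschitzOnWith.absolutelyContinuousOnInterval (LipschitzWith.const (x i)).lipschitzOnWith
    exact h2.add (h1.absolutelyContinuousOnInterval_intervalIntegral left_mem_uIcc)
  have e : EqOn (fun s => ‖x + ∫ t in (0 : ℝ)..s, f t‖ ^ 2) (fun s =>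
      (x 0 + ∫ t in (0 : ℝ)..s, f t 0) * (x 0 + ∫ t in (0 : ℝ)..s, f t 0) +
      (x 1 + ∫ t in (0 : ℝ)..s, f t 1) * (x 1 + ∫ t in (0 : ℝ)..s, f t 1) +
      (x 2 + ∫ t in (0 : ℝ)..s, f t 2) * (x 2 + ∫ t in (0 : ℝ)..s, f t 2)) (uIcc 0 L) := by
    intro s hs
    have hsub : uIcc 0 s ⊆ uIcc 0 L := uIcc_subset_uIcc left_mem_uIcc hs
    have hcomp (i : Fin 3) : (∫ t in (0 : ℝ)..s, f t) i = ∫ t in (0 : ℝ)..s, f t i :=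
      ((EuclideanSpace.proj (𝕜 := ℝ) i).intervalIntegral_comp_comm (hf.mono_set hsub)).symm
    simp only [EuclideanSpace.real_norm_sq_eq, Fin.sum_univ_three, PiLp.add_apply, hcomp]
    ring
  have h := (((hi 0).mul (hi 0)).add ((hi 1).mul (hi 1))).add ((hi 2).mul (hi 2))
  rw [absolutelyContinuousOnInterval_iff] at h ⊢
  intro ε hε
  obtain ⟨δ, hδ, H⟩ := h ε hε
  refine ⟨δ, hδ, fun E hE hsum => ?_⟩
  refine lt_of_eq_of_lt (Finset.sum_congr rfl fun i hi => ?_) (H E hE hsum)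
  have hmem := hE.1 i hi
  exact congrArg₂ dist (e hmem.1) (e hmem.2)

/-- The right-hand side of the director equations is interval integrable. -/
lemma intervalIntegrable_drift {L : ℝ} (hL : 0 ≤ L) {κ b c : ℝ → E3} (i : Fin 3)
    (hκ : IntegrableOn κ (Icc 0 L)) (hb : ContinuousOn b (Icc 0 L))
    (hc : ContinuousOn c (Icc 0 L)) :
    IntervalIntegrable (fun t => (-κ t i) • b t + κ t 2 • c t) volume 0 L := by
  have hκ' : IntervalIntegrable κ volume 0 L :=
    (intervalIntegrable_iff_integrableOn_Icc_of_le hL).2 hκ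
  have hi (j : Fin 3) : IntervalIntegrable (fun t => κ t j) volume 0 L :=
    ⟨(EuclideanSpace.proj (𝕜 := ℝ) j).integrable_comp hκ'.1,
      (EuclideanSpace.proj (𝕜 := ℝ) j).integrable_comp hκ'.2⟩
  rw [← uIcc_of_le hL] at hb hc
  exact ((hi i).neg.smul_continuousOn hb).add ((hi 2).smul_continuousOn hc)

/-- If `w` is orthogonal to `u` and `v`, then `u' = -k' w + ω v`, `v' = -k'' w - ω u` imply that
`|u|² + |v|²` has derivative zero. -/
lemma norm_sq_add_norm_sq_eq {L : ℝ} (hL : 0 ≤ L) {κ u v w : ℝ → E3} {u₀ v₀ : E3}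
    (hκ : IntegrableOn κ (Icc 0 L)) (hu : ContinuousOn u (Icc 0 L))
    (hv : ContinuousOn v (Icc 0 L)) (hw : ContinuousOn w (Icc 0 L))
    (huw : ∀ t, inner ℝ (u t) (w t) = 0) (hvw : ∀ t, inner ℝ (v t) (w t) = 0)
    (eq_u : ∀ s ∈ Icc 0 L, u s = u₀ + ∫ t in (0 : ℝ)..s, (-κ t 0) • w t + κ t 2 • v t)
    (eq_v : ∀ s ∈ Icc 0 L, v s = v₀ + ∫ t in (0 : ℝ)..s, (-κ t 1) • w t - κ t 2 • u t)
    {s : ℝ} (hs : s ∈ Icc 0 L) :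
    ‖u s‖ ^ 2 + ‖v s‖ ^ 2 = ‖u₀‖ ^ 2 + ‖v₀‖ ^ 2 := by
  set fu : ℝ → E3 := fun t => (-κ t 0) • w t + κ t 2 • v t with hfu
  set fv : ℝ → E3 := fun t => (-κ t 1) • w t - κ t 2 • u t with hfv
  have iu : IntervalIntegrable fu volume 0 L := intervalIntegrable_drift hL 0 hκ hw hv
  have iv : IntervalIntegrable fv volume 0 L := by
    have := intervalIntegrable_drift hL 1 hκ hw hu.neg
    simpa only [Pi.neg_apply, smul_neg, ← sub_eq_add_neg] using this
  have hac := (absolutelyContinuousOnInterval_norm_sq u₀ iu).add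
    (absolutelyContinuousOnInterval_norm_sq v₀ iv)
  have hder : ∀ᵐ x, x ∈ uIcc 0 L → HasDerivAt ((fun s => ‖u₀ + ∫ t in (0 : ℝ)..s, fu t‖ ^ 2) +
      fun s => ‖v₀ + ∫ t in (0 : ℝ)..s, fv t‖ ^ 2) 0 x := by
    filter_upwards [iu.ae_hasDerivAt_integral, iv.ae_hasDerivAt_integral] with x hdu hdv hx
    have h1 := ((hdu hx 0 left_mem_uIcc).const_add u₀).norm_sq
    have h2 := ((hdv hx 0 left_mem_uIcc).const_add v₀).norm_sq
    refine (h1.add h2).congr_deriv ?_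
    rw [uIcc_of_le hL] at hx
    rw [← eq_u x hx, ← eq_v x hx]
    simp only [hfu, hfv, inner_add_right, inner_sub_right, real_inner_smul_right, huw, hvw,
      real_inner_comm (u x) (v x)]
    ring
  obtain ⟨C, hC⟩ := hac.const_of_ae_hasDerivAt_zero hder
  have e0 := hC 0 left_mem_uIcc
  have e1 := hC s (by rwa [uIcc_of_le hL])
  simp only [Pi.add_apply, intervalIntegral.integral_same, add_zero] at e0
  simp only [Pi.add_apply] at e1
  rw [eq_u s hs, eq_v s hs]
  linarith

/-- The directors of a solution stay bounded. -/
lemma SolvesIVP.norm_sq_add_norm_sq {L : ℝ} (hL : 0 ≤ L) {κ : ℝ → E3} {r₀ u₀ v₀ : E3} {F : Frame}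
    (h : SolvesIVP L κ r₀ u₀ v₀ F) (hκ : IntegrableOn κ (Icc 0 L))
    (h₀ : IsOrthonormalPair u₀ v₀) {s : ℝ} (hs : s ∈ Icc 0 L) :
    ‖F.u s‖ ^ 2 + ‖F.v s‖ ^ 2 = 2 := by
  rw [norm_sq_add_norm_sq_eq hL hκ h.continuousOn_u h.continuousOn_v
    (h.continuousOn_u.cross h.continuousOn_v) (fun t => inner_cross_left_eq_zero _ _)
    (fun t => inner_cross_right_eq_zero _ _) h.eq_u h.eq_v hs, h₀.1, h₀.2.1]
  norm_num

lemma SolvesIVP.norm_u_le {L : ℝ} (hL : 0 ≤ L) {κ : ℝ → E3} {r₀ u₀ v₀ : E3} {F : Frame}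
    (h : SolvesIVP L κ r₀ u₀ v₀ F) (hκ : IntegrableOn κ (Icc 0 L))
    (h₀ : IsOrthonormalPair u₀ v₀) {s : ℝ} (hs : s ∈ Icc 0 L) : ‖F.u s‖ ≤ 2 := by
  nlinarith [h.norm_sq_add_norm_sq hL hκ h₀ hs, norm_nonneg (F.u s), norm_nonneg (F.v s)]

lemma SolvesIVP.norm_v_le {L : ℝ} (hL : 0 ≤ L) {κ : ℝ → E3} {r₀ u₀ v₀ : E3} {F : Frame}
    (h : SolvesIVP L κ r₀ u₀ v₀ F) (hκ : IntegrableOn κ (Icc 0 L))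
    (h₀ : IsOrthonormalPair u₀ v₀) {s : ℝ} (hs : s ∈ Icc 0 L) : ‖F.v s‖ ≤ 2 := by
  nlinarith [h.norm_sq_add_norm_sq hL hκ h₀ hs, norm_nonneg (F.u s), norm_nonneg (F.v s)]

/-- Gronwall's inequality with an integrable coefficient `a`. The constant `G` depends on `a` only
through a bound `A` of its integral and a length `η` such that the integral of `a` over intervals
of length at most `η` is at most `1 / 2`. -/
theorem exists_gronwall_const {L η : ℝ} (hL : 0 ≤ L) (hη : 0 < η) {A : ℝ} (hA : 0 ≤ A) :
    ∃ G > 0, ∀ a φ : ℝ → ℝ, IntervalIntegrable a volume 0 L → (∀ t, 0 ≤ a t) →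
      (∫ t in (0 : ℝ)..L, a t) ≤ A →
      (∀ x ∈ Icc 0 L, ∀ y ∈ Icc 0 L, x ≤ y → y - x ≤ η → ∫ t in x..y, a t ≤ 1 / 2) →
      ContinuousOn φ (Icc 0 L) → ∀ c, 0 ≤ c →
      (∀ s ∈ Icc 0 L, φ s ≤ c + ∫ t in (0 : ℝ)..s, a t * φ t) →
      ∀ s ∈ Icc 0 L, φ s ≤ c * G := by
  -- the bound is propagated from `[0, n η]` to `[0, (n + 1) η]`: on the last piece the integral of
  -- `a φ` is at most half of the maximum of `φ` and is absorbed
  have step : ∀ n : ℕ, ∃ G > 0, ∀ a φ : ℝ → ℝ, IntervalIntegrable a volume 0 L → (∀ t, 0 ≤ a t) →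
      (∫ t in (0 : ℝ)..L, a t) ≤ A →
      (∀ x ∈ Icc 0 L, ∀ y ∈ Icc 0 L, x ≤ y → y - x ≤ η → ∫ t in x..y, a t ≤ 1 / 2) →
      ContinuousOn φ (Icc 0 L) → ∀ c, 0 ≤ c →
      (∀ s ∈ Icc 0 L, φ s ≤ c + ∫ t in (0 : ℝ)..s, a t * φ t) →
      ∀ s ∈ Icc 0 L, s ≤ n * η → φ s ≤ c * G := by
    intro n
    induction n with
    | zero =>
      refine ⟨1, one_pos, fun a φ _ _ _ _ _ c _ h s hs hs0 => ?_⟩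
      have : s = 0 := le_antisymm (by simpa using hs0) hs.1
      have h1 := h s hs
      rw [this, intervalIntegral.integral_same] at h1
      rw [this]
      linarith
    | succ n ih =>
      obtain ⟨G, hG, ih⟩ := ih
      refine ⟨2 * (1 + A * G) + G, by positivity, fun a φ ha ha0 haA hloc hφ c hc h => ?_⟩
      have ih' := ih a φ ha ha0 haA hloc hφ c hc h
      have haL (x y : ℝ) (hx : x ∈ Icc 0 L) (hy : y ∈ Icc 0 L) : IntervalIntegrable a volume x y :=
        ha.mono_set (by rw [uIcc_of_le hL]; exact uIcc_subset_Icc hx hy)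
      have haφ (x y : ℝ) (hx : x ∈ Icc 0 L) (hy : y ∈ Icc 0 L) :
          IntervalIntegrable (fun t => a t * φ t) volume x y :=
        (haL x y hx hy).mul_continuousOn (hφ.mono (uIcc_subset_Icc hx hy))
      have h0L : (0 : ℝ) ∈ Icc 0 L := left_mem_Icc.2 hL
      set m := min ((n + 1 : ℕ) * η) L with hm
      have hm0 : 0 ≤ m := le_min (by positivity) hL
      have hmL : Icc 0 m ⊆ Icc 0 L := Icc_subset_Icc_right (min_le_right _ _)
      obtain ⟨s', hs', hmax⟩ := isCompact_Icc.exists_isMaxOn (nonempty_Icc.2 hm0) (hφ.mono hmL)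
      have hs'L := hmL hs'
      have hcG : 0 ≤ c * G := by positivity
      -- it suffices to bound the maximum of `φ`
      suffices hφs' : φ s' ≤ c * (2 * (1 + A * G) + G) by
        intro s hs hsn
        exact (isMaxOn_iff.1 hmax s ⟨hs.1, le_min hsn hs.2⟩).trans hφs'
      have hAG : 0 ≤ c * (2 * (1 + A * G)) := by positivity
      rcases le_or_gt s' (n * η) with hsn | hsn
      · have := ih' s' hs'L hsn
        linarith
      have hx : (n : ℝ) * η ∈ Icc 0 L := ⟨by positivity, hsn.le.trans hs'L.2⟩
      have hsub : s' - n * η ≤ η := by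
        have := hs'.2.trans (min_le_left _ _)
        push_cast at this
        linarith
      have h1 := h s' hs'L
      rw [← intervalIntegral.integral_add_adjacent_intervals (haφ 0 _ h0L hx)
        (haφ _ s' hx hs'L)] at h1
      have h2 : ∫ t in (0 : ℝ)..n * η, a t * φ t ≤ A * (c * G) := by
        calc ∫ t in (0 : ℝ)..n * η, a t * φ t ≤ ∫ t in (0 : ℝ)..n * η, a t * (c * G) := by
              refine intervalIntegral.integral_mono_on hx.1 (haφ 0 _ h0L hx)
                ((haL 0 _ h0L hx).mul_const _) fun t ht => ?_
              exact mul_le_mul_of_nonneg_left (ih' t ⟨ht.1, ht.2.trans hx.2⟩ ht.2) (ha0 t)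
          _ = (∫ t in (0 : ℝ)..n * η, a t) * (c * G) := intervalIntegral.integral_mul_const _ _
          _ ≤ A * (c * G) := by
              refine mul_le_mul_of_nonneg_right (le_trans ?_ haA) hcG
              exact intervalIntegral.integral_mono_interval le_rfl hx.1 hx.2
                (Eventually.of_forall ha0) ha
      rcases le_or_gt (φ s') 0 with hneg | hpos
      · linarith [mul_nonneg hc hG.le]
      have h3 : ∫ t in n * η..s', a t * φ t ≤ 1 / 2 * φ s' := by
        calc ∫ t in n * η..s', a t * φ t ≤ ∫ t in n * η..s', a t * φ s' := by
              refine intervalIntegral.integral_mono_on hsn.le (haφ _ _ hx hs'L)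
                ((haL _ _ hx hs'L).mul_const _) fun t ht => ?_
              refine mul_le_mul_of_nonneg_left (isMaxOn_iff.1 hmax t ?_) (ha0 t)
              exact ⟨hx.1.trans ht.1, ht.2.trans hs'.2⟩
          _ = (∫ t in n * η..s', a t) * φ s' := intervalIntegral.integral_mul_const _ _
          _ ≤ 1 / 2 * φ s' :=
              mul_le_mul_of_nonneg_right (hloc _ hx _ hs'L hsn.le hsub) hpos.le
      nlinarith
  obtain ⟨n, hn⟩ := exists_nat_ge (L / η)
  obtain ⟨G, hG, H⟩ := step n
  refine ⟨G, hG, fun a φ ha ha0 haA hloc hφ c hc h s hs => ?_⟩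
  refine H a φ ha ha0 haA hloc hφ c hc h s hs (hs.2.trans ?_)
  rwa [div_le_iff₀ hη] at hn

/-! ### Weakly convergent densities -/

section Lp

variable {p : ℝ≥0∞} [Fact (1 ≤ p)] {L : ℝ}

lemma integrableOn_of_Lp (κ : Lp E3 p (volume.restrict (Icc 0 L))) :
    IntegrableOn κ (Icc 0 L) := (Lp.memLp κ).integrable Fact.out

/-- Hölder's inequality on a subinterval. -/
lemma integral_norm_Lp_le (hp_top : p ≠ ⊤) (κ : Lp E3 p (volume.restrict (Icc 0 L))) {x y : ℝ}
    (hx : x ∈ Icc 0 L) (hy : y ∈ Icc 0 L) (hxy : x ≤ y) :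
    ∫ t in x..y, ‖κ t‖ ≤ ‖κ‖ * (y - x) ^ (1 - 1 / p.toReal) := by
  have hp : (1 : ℝ≥0∞) ≤ p := Fact.out
  have hp1 : 1 ≤ p.toReal := by
    simpa using ENNReal.toReal_mono hp_top hp
  have hsub : Ioc x y ⊆ Icc 0 L := fun t ht => ⟨hx.1.trans ht.1.le, ht.2.trans hy.2⟩
  have hμ : volume.restrict (Ioc x y) ≤ (volume : Measure ℝ).restrict (Icc 0 L) :=
    Measure.restrict_mono hsub le_rfl
  have hmeas : AEStronglyMeasurable κ (volume.restrict (Ioc x y)) :=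
    (Lp.aestronglyMeasurable κ).mono_measure hμ
  have h1 := eLpNorm_le_eLpNorm_mul_rpow_measure_univ hp hmeas
  have h2 : eLpNorm κ p (volume.restrict (Ioc x y)) ≤ ENNReal.ofReal ‖κ‖ := by
    rw [Lp.norm_def, ENNReal.ofReal_toReal (Lp.eLpNorm_ne_top κ)]
    exact eLpNorm_mono_measure _ hμ
  rw [intervalIntegral.integral_of_le hxy, integral_norm_eq_lintegral_enorm hmeas,
    ← eLpNorm_one_eq_lintegral_enorm]
  have hexp : 0 ≤ 1 - 1 / p.toReal := by
    rw [sub_nonneg, div_le_one (by linarith)]; exact hp1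
  refine ENNReal.toReal_le_of_le_ofReal (mul_nonneg (norm_nonneg _)
    (Real.rpow_nonneg (sub_nonneg.2 hxy) _)) (h1.trans ?_)
  rw [ENNReal.ofReal_mul (norm_nonneg _), Measure.restrict_apply_univ, Real.volume_Ioc,
    ← ENNReal.ofReal_rpow_of_nonneg (sub_nonneg.2 hxy) hexp]
  simp only [ENNReal.toReal_one, div_one]
  gcongr

/-- Densities that are bounded in `L^p`, `p > 1`, have small integrals over short intervals. -/
lemma exists_integral_norm_Lp_le (hp_one : 1 < p) (hp_top : p ≠ ⊤) (B : ℝ) {ε : ℝ} (hε : 0 < ε) :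
    ∃ η > 0, ∀ κ : Lp E3 p (volume.restrict (Icc 0 L)), ‖κ‖ ≤ B → ∀ x ∈ Icc 0 L, ∀ y ∈ Icc 0 L,
      x ≤ y → y - x ≤ η → ∫ t in x..y, ‖κ t‖ ≤ ε := by
  have hp1 : 1 < p.toReal := by
    simpa using (ENNReal.toReal_lt_toReal ENNReal.one_ne_top hp_top).2 hp_one
  have hexp : 0 < 1 - 1 / p.toReal := by
    rw [sub_pos, div_lt_one (by linarith)]; exact hp1
  have hlim : Tendsto (fun η : ℝ => max B 0 * η ^ (1 - 1 / p.toReal)) (𝓝 0) (𝓝 0) := by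
    have h := (Real.continuousAt_rpow_const 0 (1 - 1 / p.toReal) (Or.inr hexp.le)).tendsto
    rw [Real.zero_rpow hexp.ne'] at h
    simpa using h.const_mul (max B 0)
  obtain ⟨η, hη, H⟩ := Metric.eventually_nhds_iff.1 (hlim.eventually (gt_mem_nhds hε))
  refine ⟨η / 2, by positivity, fun κ hκ x hx y hy hxy hyx => ?_⟩
  refine (integral_norm_Lp_le hp_top κ hx hy hxy).trans (le_trans ?_
    (H (y := y - x) (by rw [dist_zero_right, Real.norm_of_nonneg] <;> linarith)).le)
  exact mul_le_mul_of_nonneg_right (hκ.trans (le_max_left _ _))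
    (Real.rpow_nonneg (sub_nonneg.2 hxy) _)

lemma norm_drift_le (k b c : E3) (i : Fin 3) :
    ‖(-k i) • b + k 2 • c‖ ≤ ‖k‖ * (‖b‖ + ‖c‖) := by
  have h (j : Fin 3) : ‖k j‖ ≤ ‖k‖ := PiLp.norm_apply_le k j
  refine (norm_add_le _ _).trans ?_
  rw [norm_smul, norm_smul, norm_neg, mul_add]
  gcongr
  exacts [h i, h 2]

/-- For fixed bounded directors `b`, `c` the integrated right-hand side of a director equation is a
continuous linear function of the density. -/
lemma exists_driftCLM (hp_top : p ≠ ⊤) (i : Fin 3) {b c : ℝ → E3} (hb : ContinuousOn b (Icc 0 L))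
    (hc : ContinuousOn c (Icc 0 L)) {D : ℝ} (hD : ∀ t ∈ Icc 0 L, ‖b t‖ + ‖c t‖ ≤ D) {s : ℝ}
    (hs : s ∈ Icc 0 L) :
    ∃ T : Lp E3 p (volume.restrict (Icc 0 L)) →L[ℝ] E3, ∀ κ,
      T κ = ∫ t in (0 : ℝ)..s, ((-κ t i) • b t + κ t 2 • c t) := by
  have hL : 0 ≤ L := hs.1.trans hs.2
  have h0 : (0 : ℝ) ∈ Icc 0 L := left_mem_Icc.2 hL
  have hsub : uIcc 0 s ⊆ uIcc 0 L := uIcc_subset_uIcc left_mem_uIcc (by rwa [uIcc_of_le hL])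
  have hint (κ : Lp E3 p (volume.restrict (Icc 0 L))) :
      IntervalIntegrable (fun t => (-κ t i) • b t + κ t 2 • c t) volume 0 s :=
    (intervalIntegrable_drift hL i (integrableOn_of_Lp κ) hb hc).mono_set hsub
  have hae {P : ℝ → Prop} (h : ∀ᵐ t ∂(volume.restrict (Icc 0 L)), P t) :
      ∀ᵐ t, t ∈ uIoc 0 s → P t := by
    filter_upwards [(ae_restrict_iff' measurableSet_Icc).1 h] with t ht hts
    rw [uIoc_of_le hs.1] at hts
    exact ht ⟨hts.1.le, hts.2.trans hs.2⟩
  refine ⟨LinearMap.mkContinuous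
    { toFun := fun κ => ∫ t in (0 : ℝ)..s, ((-κ t i) • b t + κ t 2 • c t)
      map_add' := fun κ κ' => ?_
      map_smul' := fun a κ => ?_ } (D * s ^ (1 - 1 / p.toReal)) (fun κ => ?_), fun κ => rfl⟩
  · rw [← intervalIntegral.integral_add (hint κ) (hint κ')]
    refine intervalIntegral.integral_congr_ae ?_
    filter_upwards [hae (Lp.coeFn_add κ κ')] with t ht hts
    rw [ht hts]
    simp only [Pi.add_apply, PiLp.add_apply, neg_add, add_smul]
    abel
  · rw [RingHom.id_apply, ← intervalIntegral.integral_smul]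
    refine intervalIntegral.integral_congr_ae ?_
    filter_upwards [hae (Lp.coeFn_smul a κ)] with t ht hts
    rw [ht hts]
    simp only [Pi.smul_apply, PiLp.smul_apply, smul_add, smul_smul, smul_eq_mul, mul_neg]
  · have hD0 : 0 ≤ D := le_trans (by positivity) (hD 0 h0)
    have hκ : IntervalIntegrable (fun t => ‖κ t‖ * D) volume 0 s :=
      (((intervalIntegrable_iff_integrableOn_Icc_of_le hL).2
        (integrableOn_of_Lp κ)).mono_set hsub).norm.mul_const D
    calc ‖∫ t in (0 : ℝ)..s, ((-κ t i) • b t + κ t 2 • c t)‖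
        ≤ ∫ t in (0 : ℝ)..s, ‖κ t‖ * D := by
          refine intervalIntegral.norm_integral_le_of_norm_le hs.1
            (Eventually.of_forall fun t ht => (norm_drift_le _ _ _ _).trans ?_) hκ
          exact mul_le_mul_of_nonneg_left (hD t ⟨ht.1.le, ht.2.trans hs.2⟩) (norm_nonneg _)
      _ = (∫ t in (0 : ℝ)..s, ‖κ t‖) * D := intervalIntegral.integral_mul_const _ _
      _ ≤ ‖κ‖ * (s - 0) ^ (1 - 1 / p.toReal) * D := by
          gcongr
          exact integral_norm_Lp_le hp_top κ h0 hs hs.1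
      _ = D * s ^ (1 - 1 / p.toReal) * ‖κ‖ := by rw [sub_zero]; ring

end Lp

/-- Pointwise convergence to zero of equicontinuous functions on a compact interval is uniform. -/
lemma eventually_norm_le_of_equicontinuous {f : ℕ → ℝ → E3} {L : ℝ}
    (hpt : ∀ s ∈ Icc 0 L, Tendsto (fun k => f k s) atTop (𝓝 0))
    (hmod : ∀ ε > 0, ∃ η > 0, ∀ k, ∀ x ∈ Icc 0 L, ∀ y ∈ Icc 0 L, x ≤ y → y - x ≤ η →
      ‖f k y - f k x‖ ≤ ε) {ε : ℝ} (hε : 0 < ε) :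
    ∀ᶠ k in atTop, ∀ s ∈ Icc 0 L, ‖f k s‖ ≤ ε := by
  obtain ⟨η, hη, hmod⟩ := hmod (ε / 2) (by positivity)
  obtain ⟨t, htL, htf, hcov⟩ := (isCompact_Icc (a := (0 : ℝ)) (b := L)).finite_cover_balls hη
  have h : ∀ᶠ k in atTop, ∀ x ∈ t, ‖f k x‖ ≤ ε / 2 := by
    rw [eventually_all_finite htf]
    intro x hx
    have h0 : ‖(0 : E3)‖ < ε / 2 := by rw [norm_zero]; exact half_pos hε
    have := (hpt x (htL hx)).norm.eventually_lt_const h0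
    exact this.mono fun k hk => hk.le
  filter_upwards [h] with k hk s hs
  obtain ⟨x, hx, hsx⟩ := mem_iUnion₂.1 (hcov hs)
  rw [Metric.mem_ball, Real.dist_eq] at hsx
  have hfx := hk x hx
  have hd : ‖f k s - f k x‖ ≤ ε / 2 := by
    rcases le_total x s with hxs | hxs
    · exact hmod k x (htL hx) s hs hxs ((le_abs_self _).trans hsx.le)
    · rw [norm_sub_rev]
      exact hmod k s hs x (htL hx) hxs ((neg_sub s x ▸ neg_le_abs _).trans hsx.le)
  have := norm_add_le (f k s - f k x) (f k x)
  rw [sub_add_cancel] at this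
  linarith

/-! ### Midlines and directors depend continuously on the densities in the weak topology -/

section Convergence

variable {p : ℝ≥0∞} [Fact (1 ≤ p)] {L : ℝ}

/-- The difference of two solutions of a director equation, estimated by the difference of the
directors (weighted with the first density) and by the integrated difference `e` of the densities,
in which the directors of the second solution are frozen. -/
lemma norm_director_sub_le {κ κ' : Lp E3 p (volume.restrict (Icc 0 L))} (hL : 0 ≤ L) (i : Fin 3)
    {x x₀ x' x₀' e : E3} {b c b' c' : ℝ → E3} {s : ℝ} (hs : s ∈ Icc 0 L)
    (hb : ContinuousOn b (Icc 0 L)) (hc : ContinuousOn c (Icc 0 L))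
    (hb' : ContinuousOn b' (Icc 0 L)) (hc' : ContinuousOn c' (Icc 0 L))
    (hx : x = x₀ + ∫ t in (0 : ℝ)..s, ((-κ t i) • b t + κ t 2 • c t))
    (hx' : x' = x₀' + ∫ t in (0 : ℝ)..s, ((-κ' t i) • b' t + κ' t 2 • c' t))
    (he : e = (∫ t in (0 : ℝ)..s, ((-κ t i) • b' t + κ t 2 • c' t)) -
      ∫ t in (0 : ℝ)..s, ((-κ' t i) • b' t + κ' t 2 • c' t)) {φ : ℝ → ℝ}
    (hφc : ContinuousOn φ (Icc 0 L)) (hφ : ∀ t ∈ Icc 0 L, ‖b t - b' t‖ + ‖c t - c' t‖ ≤ φ t) :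
    ‖x - x'‖ ≤ ‖x₀ - x₀'‖ + ‖e‖ + ∫ t in (0 : ℝ)..s, ‖κ t‖ * φ t := by
  have hsub : uIcc 0 s ⊆ uIcc 0 L := uIcc_subset_uIcc left_mem_uIcc (by rwa [uIcc_of_le hL])
  have i1 := (intervalIntegrable_drift hL i (integrableOn_of_Lp κ) hb hc).mono_set hsub
  have i2 := (intervalIntegrable_drift hL i (integrableOn_of_Lp κ) hb' hc').mono_set hsub
  have i3 : IntervalIntegrable (fun t => ‖κ t‖ * φ t) volume 0 s :=
    ((((intervalIntegrable_iff_integrableOn_Icc_of_le hL).2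
      (integrableOn_of_Lp κ)).norm.mul_continuousOn (by rwa [uIcc_of_le hL])).mono_set hsub)
  have key : x - x' = (x₀ - x₀') + e + ∫ t in (0 : ℝ)..s,
      ((-κ t i) • (b t - b' t) + κ t 2 • (c t - c' t)) := by
    have : ∫ t in (0 : ℝ)..s, ((-κ t i) • (b t - b' t) + κ t 2 • (c t - c' t)) =
        (∫ t in (0 : ℝ)..s, ((-κ t i) • b t + κ t 2 • c t)) -
          ∫ t in (0 : ℝ)..s, ((-κ t i) • b' t + κ t 2 • c' t) := by
      rw [← intervalIntegral.integral_sub i1 i2]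
      congr 1
      ext1 t
      simp only [smul_sub]
      abel
    rw [this, hx, hx', he]
    abel
  rw [key]
  refine (norm_add_le _ _).trans (add_le_add (norm_add_le _ _) ?_)
  refine intervalIntegral.norm_integral_le_of_norm_le hs.1 (Eventually.of_forall fun t ht => ?_) i3
  refine (norm_drift_le _ _ _ _).trans ?_
  exact mul_le_mul_of_nonneg_left (hφ t ⟨ht.1.le, ht.2.trans hs.2⟩) (norm_nonneg _)

/-- If `κ_k` converges weakly to `κ`, then the right-hand sides of the director equations, with
frozen directors, converge after integration, uniformly on `[0, L]`. -/
lemma eventually_norm_drift_sub_le (hp_one : 1 < p) (hp_top : p ≠ ⊤) (hL : 0 ≤ L)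
    {κs : ℕ → Lp E3 p (volume.restrict (Icc 0 L))} {κ : Lp E3 p (volume.restrict (Icc 0 L))}
    (hweak : ∀ T : Lp E3 p (volume.restrict (Icc 0 L)) →L[ℝ] E3,
      Tendsto (fun k => T (κs k)) atTop (𝓝 (T κ))) {B : ℝ} (hB : ∀ k, ‖κs k‖ ≤ B) (i : Fin 3)
    {b c : ℝ → E3} (hb : ContinuousOn b (Icc 0 L)) (hc : ContinuousOn c (Icc 0 L)) {ε : ℝ}
    (hε : 0 < ε) :
    ∀ᶠ k in atTop, ∀ s ∈ Icc 0 L, ‖(∫ t in (0 : ℝ)..s, ((-κs k t i) • b t + κs k t 2 • c t)) -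
      ∫ t in (0 : ℝ)..s, ((-κ t i) • b t + κ t 2 • c t)‖ ≤ ε := by
  obtain ⟨D₁, hD₁⟩ := isCompact_Icc.exists_bound_of_continuousOn hb
  obtain ⟨D₂, hD₂⟩ := isCompact_Icc.exists_bound_of_continuousOn hc
  have hD (t : ℝ) (ht : t ∈ Icc 0 L) : ‖b t‖ + ‖c t‖ ≤ D₁ + D₂ := add_le_add (hD₁ t ht) (hD₂ t ht)
  have h0 : (0 : ℝ) ∈ Icc 0 L := left_mem_Icc.2 hL
  have hDpos : 0 ≤ D₁ + D₂ := le_trans (by positivity) (hD 0 h0)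
  have hint (κ' : Lp E3 p (volume.restrict (Icc 0 L))) {x y : ℝ} (hx : x ∈ Icc 0 L)
      (hy : y ∈ Icc 0 L) :
      IntervalIntegrable (fun t => (-κ' t i) • b t + κ' t 2 • c t) volume x y :=
    (intervalIntegrable_drift hL i (integrableOn_of_Lp κ') hb hc).mono_set
      (by rw [uIcc_of_le hL]; exact uIcc_subset_Icc hx hy)
  refine eventually_norm_le_of_equicontinuous (fun s hs => ?_) (fun ε hε => ?_) hε
  · obtain ⟨T, hT⟩ := exists_driftCLM hp_top i hb hc hD hs
    simp only [← hT]
    simpa using (hweak T).sub_const (T κ)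
  · obtain ⟨η, hη, H⟩ := exists_integral_norm_Lp_le (L := L) hp_one hp_top (max B ‖κ‖)
      (ε := ε / (2 * (D₁ + D₂ + 1))) (by positivity)
    refine ⟨η, hη, fun k x hx y hy hxy hyx => ?_⟩
    have hone (κ' : Lp E3 p (volume.restrict (Icc 0 L))) (hκ' : ‖κ'‖ ≤ max B ‖κ‖) :
        ‖∫ t in x..y, ((-κ' t i) • b t + κ' t 2 • c t)‖ ≤ ε / 2 := by
      have hn : IntervalIntegrable (fun t => ‖κ' t‖ * (D₁ + D₂)) volume x y :=
        (((intervalIntegrable_iff_integrableOn_Icc_of_le hL).2 (integrableOn_of_Lp κ')).mono_set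
          (by rw [uIcc_of_le hL]; exact uIcc_subset_Icc hx hy)).norm.mul_const _
      calc ‖∫ t in x..y, ((-κ' t i) • b t + κ' t 2 • c t)‖
          ≤ ∫ t in x..y, ‖κ' t‖ * (D₁ + D₂) := by
            refine intervalIntegral.norm_integral_le_of_norm_le hxy
              (Eventually.of_forall fun t ht => (norm_drift_le _ _ _ _).trans ?_) hn
            exact mul_le_mul_of_nonneg_left (hD t ⟨hx.1.trans ht.1.le, ht.2.trans hy.2⟩)
              (norm_nonneg _)
        _ = (∫ t in x..y, ‖κ' t‖) * (D₁ + D₂) := intervalIntegral.integral_mul_const _ _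
        _ ≤ ε / (2 * (D₁ + D₂ + 1)) * (D₁ + D₂ + 1) := by
            exact mul_le_mul (H κ' hκ' x hx y hy hxy hyx) (by linarith) hDpos (by positivity)
        _ = ε / 2 := by field_simp
    have hadd (κ' : Lp E3 p (volume.restrict (Icc 0 L))) :=
      intervalIntegral.integral_interval_sub_left (hint κ' h0 hy) (hint κ' h0 hx)
    have h1 := hone (κs k) ((hB k).trans (le_max_left _ _))
    have h2 := hone κ (le_max_right _ _)
    rw [← hadd] at h1 h2
    rw [sub_sub_sub_comm]
    exact (norm_sub_le _ _).trans (by linarith)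

/-- If the densities converge weakly in `L^p` and the initial values converge, then midlines and
directors converge uniformly. -/
theorem eventually_frame_close (hp_one : 1 < p) (hp_top : p ≠ ⊤) (hL : 0 ≤ L)
    {κs : ℕ → Lp E3 p (volume.restrict (Icc 0 L))} {κ : Lp E3 p (volume.restrict (Icc 0 L))}
    (hweak : ∀ T : Lp E3 p (volume.restrict (Icc 0 L)) →L[ℝ] E3,
      Tendsto (fun k => T (κs k)) atTop (𝓝 (T κ))) {B : ℝ} (hB : ∀ k, ‖κs k‖ ≤ B)
    {rs us vs : ℕ → E3} {r₀ u₀ v₀ : E3} (hr : Tendsto rs atTop (𝓝 r₀))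
    (hu : Tendsto us atTop (𝓝 u₀)) (hv : Tendsto vs atTop (𝓝 v₀))
    (hso : ∀ k, IsOrthonormalPair (us k) (vs k)) (ho : IsOrthonormalPair u₀ v₀)
    {Fs : ℕ → Frame} {F : Frame} (hFs : ∀ k, SolvesIVP L (κs k) (rs k) (us k) (vs k) (Fs k))
    (hF : SolvesIVP L κ r₀ u₀ v₀ F) {ε : ℝ} (hε : 0 < ε) :
    ∀ᶠ k in atTop, ∀ s ∈ Icc 0 L,
      ‖(Fs k).r s - F.r s‖ < ε ∧ ‖(Fs k).u s - F.u s‖ < ε ∧ ‖(Fs k).v s - F.v s‖ < ε := by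
  have hB0 : 0 ≤ B := (norm_nonneg _).trans (hB 0)
  have h0 : (0 : ℝ) ∈ Icc 0 L := left_mem_Icc.2 hL
  have hLmem : L ∈ Icc 0 L := right_mem_Icc.2 hL
  obtain ⟨η, hη, Hη⟩ := exists_integral_norm_Lp_le (L := L) hp_one hp_top B (ε := 1 / 12)
    (by norm_num)
  have hA : 0 ≤ 6 * (B * L ^ (1 - 1 / p.toReal)) := by positivity
  obtain ⟨G, hG, gron⟩ := exists_gronwall_const hL hη hA
  -- directors within `ε₁` and `|w - w'| ≤ 2 ε₁` keep the midlines within `ε₁ / 2 + 2 ε₁ L < ε`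
  set ε₁ := ε / (2 * (1 + 2 * L)) with hε₁
  have hε₁0 : 0 < ε₁ := by positivity
  have hε₁le : ε₁ < ε := by
    rw [hε₁, div_lt_iff₀ (by positivity)]; nlinarith
  set δ := ε₁ / (4 * G) with hδdef
  have hδ : 0 < δ := by positivity
  have hwF : ContinuousOn F.w (Icc 0 L) := hF.continuousOn_u.cross hF.continuousOn_v
  have hdu := eventually_norm_drift_sub_le hp_one hp_top hL hweak hB 0 hwF hF.continuousOn_v hδ
  have hdv := eventually_norm_drift_sub_le hp_one hp_top hL hweak hB 1 hwF
    hF.continuousOn_u.neg hδ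
  have hu' := (tendsto_iff_norm_sub_tendsto_zero.1 hu).eventually_lt_const hδ
  have hv' := (tendsto_iff_norm_sub_tendsto_zero.1 hv).eventually_lt_const hδ
  have hr' := (tendsto_iff_norm_sub_tendsto_zero.1 hr).eventually_lt_const
    (half_pos hε₁0)
  filter_upwards [hdu, hdv, hu', hv', hr'] with k hdu hdv hu' hv' hr'
  have hw : ContinuousOn (Fs k).w (Icc 0 L) :=
    (hFs k).continuousOn_u.cross (hFs k).continuousOn_v
  let φ : ℝ → ℝ := fun t => ‖(Fs k).u t - F.u t‖ + ‖(Fs k).v t - F.v t‖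
  have hφ : ContinuousOn φ (Icc 0 L) :=
    ((hFs k).continuousOn_u.sub hF.continuousOn_u).norm.add
      ((hFs k).continuousOn_v.sub hF.continuousOn_v).norm
  have hwle (t : ℝ) (ht : t ∈ Icc 0 L) : ‖(Fs k).w t - F.w t‖ ≤ 2 * φ t := by
    have e : (Fs k).w t - F.w t =
        cross ((Fs k).u t - F.u t) ((Fs k).v t) + cross (F.u t) ((Fs k).v t - F.v t) := by
      simp only [Frame.w, cross_sub_left, cross_sub_right]
      abel
    have h1 := (hFs k).norm_v_le hL (integrableOn_of_Lp _) (hso k) ht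
    have h2 := hF.norm_u_le hL (integrableOn_of_Lp _) ho ht
    rw [e]
    refine (norm_add_le _ _).trans ((add_le_add (norm_cross_le _ _) (norm_cross_le _ _)).trans ?_)
    have h3 := mul_le_mul_of_nonneg_left h1 (norm_nonneg ((Fs k).u t - F.u t))
    have h4 := mul_le_mul_of_nonneg_right h2 (norm_nonneg ((Fs k).v t - F.v t))
    simp only [φ]
    linarith
  have hφ3 : ContinuousOn (fun t => 3 * φ t) (Icc 0 L) := hφ.const_mul 3
  have hκ : IntervalIntegrable (fun t => ‖κs k t‖) volume 0 L :=
    ((intervalIntegrable_iff_integrableOn_Icc_of_le hL).2 (integrableOn_of_Lp (κs k))).norm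
  -- Gronwall's inequality for the sum of the two director differences
  have hφle : ∀ s ∈ Icc 0 L, φ s ≤ 4 * δ * G := by
    refine gron (fun t => 6 * ‖κs k t‖) φ (hκ.const_mul 6) (fun t => by positivity) ?_ ?_ hφ
      (4 * δ) (by positivity) fun s hs => ?_
    · rw [intervalIntegral.integral_const_mul]
      have := integral_norm_Lp_le hp_top (κs k) h0 hLmem hL
      rw [sub_zero] at this
      gcongr
      refine this.trans ?_
      gcongr
      exact hB k
    · intro x hx y hy hxy hyx
      rw [intervalIntegral.integral_const_mul]
      have := Hη (κs k) (hB k) x hx y hy hxy hyx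
      linarith
    · have h1 := norm_director_sub_le hL 0 hs hw (hFs k).continuousOn_v hwF hF.continuousOn_v
        ((hFs k).eq_u s hs) (hF.eq_u s hs) rfl hφ3 fun t ht => by
          have := hwle t ht
          have := norm_nonneg ((Fs k).u t - F.u t)
          simp only [φ] at *
          linarith
      have hev (κ' : Lp E3 p (volume.restrict (Icc 0 L))) (b c : ℝ → E3) :
          ∫ t in (0 : ℝ)..s, ((-κ' t 1) • b t - κ' t 2 • c t) =
            ∫ t in (0 : ℝ)..s, ((-κ' t 1) • b t + κ' t 2 • (-c) t) := by
        simp only [Pi.neg_apply, smul_neg, sub_eq_add_neg]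
      have h2 := norm_director_sub_le hL 1 hs hw (hFs k).continuousOn_u.neg hwF
        hF.continuousOn_u.neg (((hFs k).eq_v s hs).trans (by rw [hev]))
        ((hF.eq_v s hs).trans (by rw [hev])) rfl hφ3 fun t ht => by
          have := hwle t ht
          have := norm_nonneg ((Fs k).v t - F.v t)
          have e : (-(Fs k).u) t - (-F.u) t = -((Fs k).u t - F.u t) := by
            simp only [Pi.neg_apply]; abel
          rw [e, norm_neg]
          simp only [φ] at *
          linarith
      have h3 := hdu s hs
      have h4 := hdv s hs
      have h5 : ∫ t in (0 : ℝ)..s, 6 * ‖κs k t‖ * φ t =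
          (∫ t in (0 : ℝ)..s, ‖κs k t‖ * (3 * φ t)) + ∫ t in (0 : ℝ)..s, ‖κs k t‖ * (3 * φ t) := by
        rw [← two_mul, ← intervalIntegral.integral_const_mul]
        congr 1
        ext1 t
        ring
      rw [h5]
      simp only [φ] at h1 h2 ⊢
      linarith
  have hδG : 4 * δ * G = ε₁ := by rw [hδdef]; field_simp
  rw [hδG] at hφle
  intro s hs
  have hφs := hφle s hs
  have hn1 := norm_nonneg ((Fs k).u s - F.u s)
  have hn2 := norm_nonneg ((Fs k).v s - F.v s)
  simp only [φ] at hφs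
  refine ⟨?_, by linarith, by linarith⟩
  have hsub : uIcc 0 s ⊆ Icc 0 L := uIcc_subset_Icc h0 hs
  have e : (Fs k).r s - F.r s = (rs k - r₀) + ∫ t in (0 : ℝ)..s, ((Fs k).w t - F.w t) := by
    rw [intervalIntegral.integral_sub (hw.mono hsub).intervalIntegrable
      (hwF.mono hsub).intervalIntegrable, (hFs k).eq_r s hs, hF.eq_r s hs]
    abel
  have hI : ‖∫ t in (0 : ℝ)..s, ((Fs k).w t - F.w t)‖ ≤ 2 * ε₁ * |s - 0| := by
    refine intervalIntegral.norm_integral_le_of_norm_le_const fun t ht => ?_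
    rw [uIoc_of_le hs.1] at ht
    have ht' : t ∈ Icc 0 L := ⟨ht.1.le, ht.2.trans hs.2⟩
    exact (hwle t ht').trans (by linarith [hφle t ht'])
  rw [sub_zero, abs_of_nonneg hs.1] at hI
  have hI' : 2 * ε₁ * s ≤ 2 * ε₁ * L := by
    have := hs.2
    gcongr
  have hsum : ε₁ + 2 * ε₁ * L = ε / 2 := by rw [hε₁]; field_simp
  rw [e]
  refine (norm_add_le _ _).trans_lt ?_
  linarith

end Convergence

/-! ### Existence of midlines and directors -/

/-- The retraction of space onto the ball of radius `2` along rays. -/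
noncomputable def truncation (x : E3) : E3 := (2 / max 2 ‖x‖) • x

lemma truncation_eq_self {x : E3} (hx : ‖x‖ ≤ 2) : truncation x = x := by
  rw [truncation, max_eq_left hx, div_self two_ne_zero, one_smul]

lemma norm_truncation_le (x : E3) : ‖truncation x‖ ≤ 2 := by
  have h : 0 < max 2 ‖x‖ := lt_max_of_lt_left two_pos
  rw [truncation, norm_smul, Real.norm_of_nonneg (by positivity), div_mul_eq_mul_div,
    div_le_iff₀ h]
  gcongr
  exact le_max_right _ _

lemma norm_truncation_sub_le (x y : E3) : ‖truncation x - truncation y‖ ≤ 2 * ‖x - y‖ := by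
  set m := max 2 ‖x‖ with hm
  set n := max 2 ‖y‖ with hn
  have hm2 : 2 ≤ m := le_max_left _ _
  have hn2 : 2 ≤ n := le_max_left _ _
  have hyn : ‖y‖ ≤ n := le_max_right _ _
  have hmn : |n - m| ≤ ‖x - y‖ := by
    have h1 := abs_max_sub_max_le_abs ‖y‖ ‖x‖ 2
    rw [max_comm, ← hn, max_comm, ← hm] at h1
    exact h1.trans ((abs_norm_sub_norm_le y x).trans_eq (norm_sub_rev y x))
  -- both points are scaled by `2 / m`; in the remaining multiple of `y` the bound `‖y‖ ≤ n` cancels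
  -- the factor `1 / n`
  have e : truncation x - truncation y = (2 / m) • (x - y) + (2 * (n - m) / (m * n)) • y := by
    rw [truncation, truncation, ← hm, ← hn, smul_sub, sub_add, ← sub_smul]
    congr 2
    field_simp
    ring
  rw [e]
  refine (norm_add_le _ _).trans ?_
  rw [norm_smul, norm_smul, norm_div, norm_div, norm_mul, norm_mul, Real.norm_eq_abs (n - m),
    Real.norm_of_nonneg (by linarith : 0 ≤ m), Real.norm_of_nonneg (by linarith : 0 ≤ n),
    Real.norm_of_nonneg (by norm_num : (0 : ℝ) ≤ 2)]
  have h1 : 2 / m * ‖x - y‖ ≤ 1 * ‖x - y‖ := by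
    gcongr
    rwa [div_le_one (by linarith)]
  have h2 : 2 * |n - m| / (m * n) * ‖y‖ ≤ ‖x - y‖ := by
    rw [div_mul_eq_mul_div, div_le_iff₀ (by positivity)]
    have h3 : |n - m| * ‖y‖ ≤ ‖x - y‖ * n := mul_le_mul hmn hyn (norm_nonneg _) (norm_nonneg _)
    calc 2 * |n - m| * ‖y‖ = 2 * (|n - m| * ‖y‖) := mul_assoc _ _ _
      _ ≤ m * (‖x - y‖ * n) := by gcongr
      _ = ‖x - y‖ * (m * n) := by ring
  linarith

lemma continuous_truncation : Continuous truncation := by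
  refine Continuous.smul (continuous_const.div (continuous_const.max continuous_norm) fun x => ?_)
    continuous_id
  exact (lt_max_of_lt_left two_pos).ne'

lemma norm_cross_truncation_sub_le (a b a' b' : E3) :
    ‖cross (truncation a) (truncation b) - cross (truncation a') (truncation b')‖ ≤
      4 * ‖a - a'‖ + 4 * ‖b - b'‖ := by
  have e : cross (truncation a) (truncation b) - cross (truncation a') (truncation b') =
      cross (truncation a - truncation a') (truncation b) +
        cross (truncation a') (truncation b - truncation b') := by
    simp only [cross_sub_left, cross_sub_right]
    abel
  rw [e]
  refine (norm_add_le _ _).trans (add_le_add ((norm_cross_le _ _).trans ?_)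
    ((norm_cross_le _ _).trans ?_))
  · have := mul_le_mul (norm_truncation_sub_le a a') (norm_truncation_le b) (norm_nonneg _)
      (by positivity)
    linarith
  · have := mul_le_mul (norm_truncation_le a') (norm_truncation_sub_le b b') (norm_nonneg _)
      (by positivity)
    linarith

/-- For an exponential weight that decays fast enough the weighted integrals of an integrable
function are small. -/
lemma exists_exp_weight {a : ℝ → ℝ} {L : ℝ} (hL : 0 ≤ L) (ha : IntervalIntegrable a volume 0 L)
    (ha0 : ∀ t, 0 ≤ a t) :
    ∃ c, ∀ s ∈ Icc 0 L, ∫ t in (0 : ℝ)..s, a t * Real.exp (c * (t - s)) ≤ 1 / 2 := by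
  have hP : ContinuousOn (fun s => ∫ t in (0 : ℝ)..s, a t) (Icc 0 L) := by
    have := intervalIntegral.continuousOn_primitive_interval
      ((intervalIntegrable_iff_integrableOn_Icc_of_le hL).1 ha |>.congr_set_ae
        (by rw [uIcc_of_le hL]; rfl))
    rwa [uIcc_of_le hL] at this
  obtain ⟨η, hη, hPη⟩ := Metric.uniformContinuousOn_iff.1
    (isCompact_Icc.uniformContinuousOn_of_continuous hP) (1 / 4) (by norm_num)
  set A := ∫ t in (0 : ℝ)..L, a t with hA
  have hA0 : 0 ≤ A := intervalIntegral.integral_nonneg hL fun t _ => ha0 t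
  have h0L : (0 : ℝ) ∈ Icc 0 L := left_mem_Icc.2 hL
  have haL {x y : ℝ} (hx : x ∈ Icc 0 L) (hy : y ∈ Icc 0 L) : IntervalIntegrable a volume x y :=
    ha.mono_set (by rw [uIcc_of_le hL]; exact uIcc_subset_Icc hx hy)
  -- before `s - η / 2` the weight is at most `exp (-4 A)`, and `A exp (-4 A) ≤ 1 / 4`; after it the
  -- weight is at most `1`, and the integral of `a` over so short an interval is at most `1 / 4`
  refine ⟨8 * A / η, fun s hs => ?_⟩
  have hc : 0 ≤ 8 * A / η := by positivity
  have hi {x y : ℝ} (hx : x ∈ Icc 0 L) (hy : y ∈ Icc 0 L) :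
      IntervalIntegrable (fun t => a t * Real.exp (8 * A / η * (t - s))) volume x y :=
    (haL hx hy).mul_continuousOn (by fun_prop)
  set m := max 0 (s - η / 2) with hm
  have hms : m ≤ s := max_le hs.1 (by linarith)
  have hmL : m ∈ Icc 0 L := ⟨le_max_left _ _, hms.trans hs.2⟩
  have h1 : ∫ t in (0 : ℝ)..m, a t * Real.exp (8 * A / η * (t - s)) ≤ 1 / 4 := by
    rcases le_total (s - η / 2) 0 with h | h
    · rw [hm, max_eq_left h, intervalIntegral.integral_same]
      norm_num
    · have hm' : m = s - η / 2 := max_eq_right h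
      calc ∫ t in (0 : ℝ)..m, a t * Real.exp (8 * A / η * (t - s))
          ≤ ∫ t in (0 : ℝ)..m, a t * Real.exp (-(4 * A)) := by
            refine intervalIntegral.integral_mono_on hmL.1 (hi h0L hmL)
              ((haL h0L hmL).mul_const _) fun t ht => ?_
            refine mul_le_mul_of_nonneg_left (Real.exp_le_exp.2 ?_) (ha0 t)
            have h2 : t - s ≤ -(η / 2) := by linarith [ht.2]
            calc 8 * A / η * (t - s) ≤ 8 * A / η * -(η / 2) := by gcongr
              _ = -(4 * A) := by field_simp; ring
        _ = (∫ t in (0 : ℝ)..m, a t) * Real.exp (-(4 * A)) :=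
            intervalIntegral.integral_mul_const _ _
        _ ≤ A * Real.exp (-(4 * A)) := by
            gcongr
            exact intervalIntegral.integral_mono_interval le_rfl hmL.1 hmL.2
              (Eventually.of_forall ha0) ha
        _ ≤ 1 / 4 := by
            rw [Real.exp_neg, ← div_eq_mul_inv, div_le_iff₀ (Real.exp_pos _)]
            linarith [Real.add_one_le_exp (4 * A)]
  have h2 : ∫ t in m..s, a t * Real.exp (8 * A / η * (t - s)) ≤ 1 / 4 := by
    calc ∫ t in m..s, a t * Real.exp (8 * A / η * (t - s)) ≤ ∫ t in m..s, a t := by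
          refine intervalIntegral.integral_mono_on hms (hi hmL hs) (haL hmL hs) fun t ht => ?_
          refine mul_le_of_le_one_right (ha0 t) (Real.exp_le_one_iff.2 ?_)
          exact mul_nonpos_of_nonneg_of_nonpos hc (by linarith [ht.2])
      _ = (∫ t in (0 : ℝ)..s, a t) - ∫ t in (0 : ℝ)..m, a t :=
          (intervalIntegral.integral_interval_sub_left (haL h0L hs) (haL h0L hmL)).symm
      _ ≤ 1 / 4 := by
          have hd : dist s m < η := by
            rw [Real.dist_eq, abs_of_nonneg (by linarith)]
            linarith [le_max_right 0 (s - η / 2)]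
          exact (le_abs_self _).trans (hPη s hs m hmL hd).le
  rw [← intervalIntegral.integral_add_adjacent_intervals (hi h0L hmL) (hi hmL hs)]
  linarith

/-- Solutions of the director equations with the truncated vector product, by the contraction
principle in a space of continuous functions with an exponential weight. -/
lemma exists_truncated_solution {L : ℝ} (hL : 0 ≤ L) {κ : ℝ → E3} (hκ : IntegrableOn κ (Icc 0 L))
    (u₀ v₀ : E3) : ∃ u v : ℝ → E3, Continuous u ∧ Continuous v ∧
      (∀ s ∈ Icc 0 L, u s = u₀ + ∫ t in (0 : ℝ)..s,
        ((-κ t 0) • cross (truncation (u t)) (truncation (v t)) + κ t 2 • v t)) ∧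
      ∀ s ∈ Icc 0 L, v s = v₀ + ∫ t in (0 : ℝ)..s,
        ((-κ t 1) • cross (truncation (u t)) (truncation (v t)) + κ t 2 • -u t) := by
  have hκi : IntervalIntegrable κ volume 0 L :=
    (intervalIntegrable_iff_integrableOn_Icc_of_le hL).2 hκ
  have h0L : (0 : ℝ) ∈ Icc 0 L := left_mem_Icc.2 hL
  obtain ⟨c, hc⟩ := exists_exp_weight hL (hκi.norm.const_mul 9) fun t => by positivity
  -- a weighted pair `y` encodes the directors `u = exp (c t) y₁`, `v = exp (c t) y₂`
  let U (y : C(Icc (0 : ℝ) L, E3 × E3)) (t : ℝ) : E3 := Real.exp (c * t) • (IccExtend hL y t).1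
  let V (y : C(Icc (0 : ℝ) L, E3 × E3)) (t : ℝ) : E3 := Real.exp (c * t) • (IccExtend hL y t).2
  have hU (y) : Continuous (U y) :=
    (by fun_prop : Continuous fun t => Real.exp (c * t)).smul
      (continuous_fst.comp y.continuous.Icc_extend')
  have hV (y) : Continuous (V y) :=
    (by fun_prop : Continuous fun t => Real.exp (c * t)).smul
      (continuous_snd.comp y.continuous.Icc_extend')
  let W (y : C(Icc (0 : ℝ) L, E3 × E3)) (t : ℝ) : E3 :=
    cross (truncation (U y t)) (truncation (V y t))
  have hW (y) : Continuous (W y) :=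
    (continuous_truncation.comp (hU y)).cross (continuous_truncation.comp (hV y))
  let g₁ (y : C(Icc (0 : ℝ) L, E3 × E3)) (t : ℝ) : E3 := (-κ t 0) • W y t + κ t 2 • V y t
  let g₂ (y : C(Icc (0 : ℝ) L, E3 × E3)) (t : ℝ) : E3 := (-κ t 1) • W y t + κ t 2 • -U y t
  have hg₁ (y) : IntervalIntegrable (g₁ y) volume 0 L :=
    intervalIntegrable_drift hL 0 hκ (hW y).continuousOn (hV y).continuousOn
  have hg₂ (y) : IntervalIntegrable (g₂ y) volume 0 L :=
    intervalIntegrable_drift hL 1 hκ (hW y).continuousOn (hU y).neg.continuousOn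
  have hprim {g : ℝ → E3} (hg : IntervalIntegrable g volume 0 L) (x : E3) :
      Continuous fun s : Icc (0 : ℝ) L => Real.exp (-c * s) • (x + ∫ t in (0 : ℝ)..s, g t) := by
    have h1 : ContinuousOn (fun s => ∫ t in (0 : ℝ)..s, g t) (Icc 0 L) := by
      have := intervalIntegral.continuousOn_primitive_interval
        ((intervalIntegrable_iff_integrableOn_Icc_of_le hL).1 hg |>.congr_set_ae
          (by rw [uIcc_of_le hL]; rfl))
      rwa [uIcc_of_le hL] at this
    have h2 := continuousOn_iff_continuous_domRestrict.1 h1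
    exact (by fun_prop : Continuous fun s : Icc (0 : ℝ) L => Real.exp (-c * s)).smul
      (continuous_const.add h2)
  let Φ (y : C(Icc (0 : ℝ) L, E3 × E3)) : C(Icc (0 : ℝ) L, E3 × E3) :=
    ⟨fun s => (Real.exp (-c * s) • (u₀ + ∫ t in (0 : ℝ)..s, g₁ y t),
      Real.exp (-c * s) • (v₀ + ∫ t in (0 : ℝ)..s, g₂ y t)),
      (hprim (hg₁ y) u₀).prodMk (hprim (hg₂ y) v₀)⟩
  have hUV (y y') (t : ℝ) : ‖U y t - U y' t‖ ≤ Real.exp (c * t) * dist y y' ∧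
      ‖V y t - V y' t‖ ≤ Real.exp (c * t) * dist y y' := by
    have hd : ‖IccExtend hL y t - IccExtend hL y' t‖ ≤ dist y y' := by
      rw [← dist_eq_norm]
      exact ContinuousMap.dist_apply_le_dist _
    simp only [U, V, ← smul_sub, norm_smul, Real.norm_of_nonneg (Real.exp_nonneg _)]
    constructor
    · gcongr
      exact (norm_fst_le (IccExtend hL y t - IccExtend hL y' t)).trans hd
    · gcongr
      exact (norm_snd_le (IccExtend hL y t - IccExtend hL y' t)).trans hd
  have hWle (y y') (t : ℝ) : ‖W y t - W y' t‖ ≤ 8 * (Real.exp (c * t) * dist y y') := by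
    have := norm_cross_truncation_sub_le (U y t) (V y t) (U y' t) (V y' t)
    have := hUV y y' t
    linarith
  have hcontr {g g' : ℝ → E3} (hg : IntervalIntegrable g volume 0 L)
      (hg' : IntervalIntegrable g' volume 0 L) (x : E3) {y y' : C(Icc (0 : ℝ) L, E3 × E3)}
      (hle : ∀ t, ‖g t - g' t‖ ≤ ‖κ t‖ * (9 * (Real.exp (c * t) * dist y y'))) {s : ℝ}
      (hs : s ∈ Icc 0 L) :
      ‖Real.exp (-c * s) • (x + ∫ t in (0 : ℝ)..s, g t) -
        Real.exp (-c * s) • (x + ∫ t in (0 : ℝ)..s, g' t)‖ ≤ 1 / 2 * dist y y' := by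
    have hsub : uIcc 0 s ⊆ uIcc 0 L := uIcc_subset_uIcc left_mem_uIcc (by rwa [uIcc_of_le hL])
    rw [← smul_sub, add_sub_add_left_eq_sub, ← intervalIntegral.integral_sub (hg.mono_set hsub)
      (hg'.mono_set hsub), norm_smul, Real.norm_of_nonneg (Real.exp_nonneg _)]
    have hi : IntervalIntegrable (fun t => ‖κ t‖ * (9 * (Real.exp (c * t) * dist y y')))
        volume 0 s := (hκi.mono_set hsub).norm.mul_continuousOn (by fun_prop)
    calc Real.exp (-c * s) * ‖∫ t in (0 : ℝ)..s, (g t - g' t)‖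
        ≤ Real.exp (-c * s) * ∫ t in (0 : ℝ)..s, ‖κ t‖ * (9 * (Real.exp (c * t) * dist y y')) := by
          gcongr
          exact intervalIntegral.norm_integral_le_of_norm_le hs.1
            (Eventually.of_forall fun t _ => hle t) hi
      _ = (∫ t in (0 : ℝ)..s, 9 * ‖κ t‖ * Real.exp (c * (t - s))) * dist y y' := by
          rw [← intervalIntegral.integral_const_mul, ← intervalIntegral.integral_mul_const]
          congr 1
          ext1 t
          rw [show c * (t - s) = c * t + -c * s by ring, Real.exp_add]
          ring
      _ ≤ 1 / 2 * dist y y' := by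
          gcongr
          exact hc s hs
  have hΦ : ContractingWith (1 / 2) Φ := by
    refine ⟨by norm_num, LipschitzWith.of_dist_le_mul fun y y' => ?_⟩
    rw [ContinuousMap.dist_le (by positivity)]
    intro s
    rw [Prod.dist_eq, dist_eq_norm, dist_eq_norm]
    have e : ((1 / 2 : NNReal) : ℝ) = 1 / 2 := by norm_num
    rw [e]
    refine max_le (hcontr (hg₁ y) (hg₁ y') u₀ (fun t => ?_) s.2)
      (hcontr (hg₂ y) (hg₂ y') v₀ (fun t => ?_) s.2)
    · have e : g₁ y t - g₁ y' t = (-κ t 0) • (W y t - W y' t) + κ t 2 • (V y t - V y' t) := by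
        simp only [g₁, smul_sub]
        abel
      rw [e]
      refine (norm_drift_le _ _ _ _).trans ?_
      gcongr
      linarith [hWle y y' t, (hUV y y' t).2]
    · have e : g₂ y t - g₂ y' t = (-κ t 1) • (W y t - W y' t) + κ t 2 • -(U y t - U y' t) := by
        simp only [g₂, smul_sub, smul_neg]
        abel
      rw [e]
      refine (norm_drift_le _ _ _ _).trans ?_
      rw [norm_neg]
      gcongr
      linarith [hWle y y' t, (hUV y y' t).1]
  obtain ⟨y, hy, -⟩ := hΦ.exists_fixedPoint 0 (edist_ne_top _ _)
  have hval {s : ℝ} (hs : s ∈ Icc 0 L) : IccExtend hL y s = Φ y ⟨s, hs⟩ := by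
    rw [IccExtend_of_mem _ _ hs, hy.eq]
  refine ⟨U y, V y, hU y, hV y, fun s hs => ?_, fun s hs => ?_⟩
  · simp only [U, hval hs, Φ, ContinuousMap.coe_mk, smul_smul, ← Real.exp_add]
    rw [show c * s + -c * s = 0 by ring, Real.exp_zero, one_smul]
  · simp only [V, hval hs, Φ, ContinuousMap.coe_mk, smul_smul, ← Real.exp_add]
    rw [show c * s + -c * s = 0 by ring, Real.exp_zero, one_smul]

/-- Carathéodory's existence theorem for the director equations. Along rays the truncation does not
change directions, so the truncated equations preserve `|u|² + |v|² = 2`, and the truncation is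
never active. -/
theorem exists_solvesIVP {L : ℝ} (hL : 0 ≤ L) {κ : ℝ → E3} (hκ : IntegrableOn κ (Icc 0 L))
    (r₀ : E3) {u₀ v₀ : E3} (h₀ : IsOrthonormalPair u₀ v₀) :
    ∃ F, SolvesIVP L κ r₀ u₀ v₀ F := by
  obtain ⟨u, v, hu, hv, eu, ev⟩ := exists_truncated_solution hL hκ u₀ v₀
  simp only [smul_neg, ← sub_eq_add_neg] at ev
  have hort (a b : E3) : inner ℝ a (cross (truncation a) (truncation b)) = 0 ∧
      inner ℝ b (cross (truncation a) (truncation b)) = 0 := by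
    have e : cross (truncation a) (truncation b) =
        (2 / max 2 ‖a‖ * (2 / max 2 ‖b‖)) • cross a b := by
      simp only [truncation, ← crossL_apply, map_smul, smul_apply, smul_smul]
      rw [mul_comm]
    rw [e, real_inner_smul_right, real_inner_smul_right, inner_cross_left_eq_zero,
      inner_cross_right_eq_zero, mul_zero]
    exact ⟨rfl, rfl⟩
  have hnorm (s : ℝ) (hs : s ∈ Icc 0 L) : truncation (u s) = u s ∧ truncation (v s) = v s := by
    have h := norm_sq_add_norm_sq_eq hL hκ hu.continuousOn hv.continuousOn
      ((continuous_truncation.comp hu).cross (continuous_truncation.comp hv)).continuousOn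
      (fun t => (hort (u t) (v t)).1) (fun t => (hort (u t) (v t)).2) eu ev hs
    rw [h₀.1, h₀.2.1] at h
    exact ⟨truncation_eq_self (by nlinarith [norm_nonneg (u s), norm_nonneg (v s)]),
      truncation_eq_self (by nlinarith [norm_nonneg (u s), norm_nonneg (v s)])⟩
  have hsub {s : ℝ} (hs : s ∈ Icc 0 L) : uIcc 0 s ⊆ Icc 0 L :=
    uIcc_subset_Icc (left_mem_Icc.2 hL) hs
  refine ⟨⟨fun s => r₀ + ∫ t in (0 : ℝ)..s, cross (u t) (v t), u, v⟩, ?_, hu.continuousOn,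
    hv.continuousOn, fun s _ => rfl, fun s hs => ?_, fun s hs => ?_⟩
  · exact (continuous_const.add (intervalIntegral.continuous_primitive
      (fun _ _ => (hu.cross hv).intervalIntegrable _ _) 0)).continuousOn
  · refine (eu s hs).trans ?_
    congr 1
    refine intervalIntegral.integral_congr fun t ht => ?_
    obtain ⟨e1, e2⟩ := hnorm t (hsub hs ht)
    simp only [e1, e2, Frame.w]
  · refine (ev s hs).trans ?_
    congr 1
    refine intervalIntegral.integral_congr fun t ht => ?_
    obtain ⟨e1, e2⟩ := hnorm t (hsub hs ht)
    simp only [e1, e2, Frame.w]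

/-- The frame `solution` solves the initial value problem, so that its default value plays no role
for admissible configurations. -/
theorem solvesIVP_solution {L : ℝ} (hL : 0 ≤ L) {κ : ℝ → E3} (hκ : IntegrableOn κ (Icc 0 L))
    (r₀ : E3) {u₀ v₀ : E3} (h₀ : IsOrthonormalPair u₀ v₀) :
    SolvesIVP L κ r₀ u₀ v₀ (solution L κ r₀ u₀ v₀) := by
  have h := exists_solvesIVP hL hκ r₀ h₀
  rw [solution, dif_pos h]
  exact h.choose_spec

/-! ### Rods: compactness, closed midlines, convergence of the positions -/

section Rod

variable {p : ℝ≥0∞}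

lemma Rod.isCompact_Ω (B : Rod p) : IsCompact B.Ω := by
  obtain ⟨O, -, hO⟩ := B.closure_of_open
  have hclosed : IsClosed B.Ω := by
    have : B.Ω = closure O := hO
    rw [this]
    exact isClosed_closure
  refine IsCompact.of_isClosed_subset (s := Icc 0 B.L ×ˢ Icc (-B.R) B.R ×ˢ Icc (-B.R) B.R)
    (isCompact_Icc.prod (isCompact_Icc.prod isCompact_Icc)) hclosed ?_
  rintro x ⟨hx, hζ⟩
  obtain ⟨h1, h2⟩ := B.thickness _ hx _ hζ
  exact ⟨hx, abs_le.1 h1.le, abs_le.1 h2.le⟩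

lemma Rod.R_pos (B : Rod p) : 0 < B.R := by
  have h0 : (0 : ℝ) ∈ Icc 0 B.L := left_mem_Icc.2 B.L_pos.le
  have := (B.thickness 0 h0 _ (B.zero_mem_crossSection 0 h0)).1
  simpa using this

lemma Rod.mem_Ω_midline (B : Rod p) {s : ℝ} (hs : s ∈ Icc 0 B.L) : (s, 0, 0) ∈ B.Ω :=
  ⟨hs, B.zero_mem_crossSection s hs⟩

lemma Frame.position_midline (F : Frame) (s : ℝ) : F.position (s, 0, 0) = F.r s := by
  simp [Frame.position]

lemma Rod.midline_subset_body (B : Rod p) (F : Frame) : F.r '' Icc 0 B.L ⊆ B.body F := by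
  rintro _ ⟨s, hs, rfl⟩
  exact ⟨_, B.mem_Ω_midline hs, F.position_midline s⟩

lemma SolvesIVP.isCompact_body {B : Rod p} {κ : ℝ → E3} {r₀ u₀ v₀ : E3} {F : Frame}
    (h : SolvesIVP B.L κ r₀ u₀ v₀ F) : IsCompact (B.body F) := by
  refine B.isCompact_Ω.image_of_continuousOn ?_
  have hfst : MapsTo (fun x : ℝ × ℝ × ℝ => x.1) B.Ω (Icc 0 B.L) := fun x hx => hx.1
  have hr := h.continuousOn_r.comp continuousOn_fst hfst
  have hu := h.continuousOn_u.comp continuousOn_fst hfst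
  have hv := h.continuousOn_v.comp continuousOn_fst hfst
  have h1 : ContinuousOn (fun x : ℝ × ℝ × ℝ => x.2.1) B.Ω := by fun_prop
  have h2 : ContinuousOn (fun x : ℝ × ℝ × ℝ => x.2.2) B.Ω := by fun_prop
  exact (hr.add (h1.smul hu)).add (h2.smul hv)

lemma SolvesIVP.isClosedC1On {L : ℝ} (hL : 0 ≤ L) {κ : ℝ → E3} {r₀ u₀ v₀ : E3} {F : Frame}
    (h : SolvesIVP L κ r₀ u₀ v₀ F) (hcl : F.IsClosedUp L) : IsClosedC1On F.r 0 L := by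
  have hw : ContinuousOn F.w (Icc 0 L) := h.continuousOn_u.cross h.continuousOn_v
  set w : ℝ → E3 := IccExtend hL ((Icc 0 L).domRestrict F.w) with hwdef
  have hwc : Continuous w := hw.domRestrict.Icc_extend'
  have hweq : EqOn F.w w (Icc 0 L) := fun t ht => by
    rw [hwdef, IccExtend_of_mem _ _ ht]; rfl
  have he : EqOn F.r (fun s => r₀ + ∫ t in (0 : ℝ)..s, w t) (Icc 0 L) := fun s hs => by
    rw [h.eq_r s hs]
    simp only
    congr 1
    exact intervalIntegral.integral_congr fun t ht =>
      hweq (uIcc_subset_Icc (left_mem_Icc.2 hL) hs ht)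
  refine ⟨_, w, ⟨fun s => ?_, hwc, ?_⟩, he⟩
  · exact (intervalIntegral.integral_hasDerivAt_right (hwc.intervalIntegrable _ _)
      (hwc.stronglyMeasurableAtFilter _ _) hwc.continuousAt).const_add r₀
  · exact (he (left_mem_Icc.2 hL)).symm.trans (hcl.1.trans (he (right_mem_Icc.2 hL)))

/-- Under weak convergence of the densities the positions of the material points converge
uniformly. -/
lemma Rod.eventually_position_close [Fact (1 ≤ p)] (hp_one : 1 < p) (hp_top : p ≠ ⊤) (B : Rod p)
    {κs : ℕ → B.Density} {κ : B.Density}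
    (hweak : ∀ T : B.Density →L[ℝ] E3, Tendsto (fun k => T (κs k)) atTop (𝓝 (T κ)))
    {C : ℝ} (hC : ∀ k, ‖κs k‖ ≤ C) {rs us vs : ℕ → E3} {r₀ u₀ v₀ : E3}
    (hr : Tendsto rs atTop (𝓝 r₀)) (hu : Tendsto us atTop (𝓝 u₀)) (hv : Tendsto vs atTop (𝓝 v₀))
    (hso : ∀ k, IsOrthonormalPair (us k) (vs k)) (ho : IsOrthonormalPair u₀ v₀)
    {ε : ℝ} (hε : 0 < ε) :
    ∀ᶠ k in atTop, ∀ x ∈ B.Ω, ‖(solution B.L (κs k) (rs k) (us k) (vs k)).position x -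
      (solution B.L κ r₀ u₀ v₀).position x‖ < ε := by
  have hL := B.L_pos.le
  have hR := B.R_pos
  have hδ : 0 < ε / (1 + 2 * B.R) := by positivity
  filter_upwards [eventually_frame_close hp_one hp_top hL hweak hC hr hu hv hso ho
    (fun k => solvesIVP_solution hL (integrableOn_of_Lp (κs k)) (rs k) (hso k))
    (solvesIVP_solution hL (integrableOn_of_Lp κ) r₀ ho) hδ] with k hk x hx
  obtain ⟨h1, h2, h3⟩ := hk x.1 hx.1
  obtain ⟨hζ1, hζ2⟩ := B.thickness _ hx.1 _ hx.2
  set F := solution B.L κ r₀ u₀ v₀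
  set F' := solution B.L (κs k) (rs k) (us k) (vs k)
  have e : F'.position x - F.position x = (F'.r x.1 - F.r x.1) +
      x.2.1 • (F'.u x.1 - F.u x.1) + x.2.2 • (F'.v x.1 - F.v x.1) := by
    simp only [Frame.position, smul_sub]
    abel
  have h4 : ‖x.2.1 • (F'.u x.1 - F.u x.1)‖ ≤ B.R * (ε / (1 + 2 * B.R)) := by
    rw [norm_smul, Real.norm_eq_abs]
    gcongr
  have h5 : ‖x.2.2 • (F'.v x.1 - F.v x.1)‖ ≤ B.R * (ε / (1 + 2 * B.R)) := by
    rw [norm_smul, Real.norm_eq_abs]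
    gcongr
  have hsum : ε / (1 + 2 * B.R) + B.R * (ε / (1 + 2 * B.R)) + B.R * (ε / (1 + 2 * B.R)) = ε := by
    field_simp
    ring
  rw [e]
  have := norm_add₃_le (a := F'.r x.1 - F.r x.1) (b := x.2.1 • (F'.u x.1 - F.u x.1))
    (c := x.2.2 • (F'.v x.1 - F.v x.1))
  linarith

end Rod

/-! ### Weak convergence of configurations -/

lemma tendsto_of_weakTendsto {X : Type*} [NormedAddCommGroup X] [NormedSpace ℝ X] {x : ℕ → X}
    {y : X} (h : Tendsto (fun k => toWeakSpace ℝ X (x k)) atTop (𝓝 (toWeakSpace ℝ X y)))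
    (T : X →L[ℝ] ℝ) : Tendsto (fun k => T (x k)) atTop (𝓝 (T y)) :=
  ((WeakBilin.eval_continuous (topDualPairing ℝ X).flip T).tendsto _).comp h

lemma tendsto_E3_of_weakTendsto {X : Type*} [NormedAddCommGroup X] [NormedSpace ℝ X] {x : ℕ → X}
    {y : X} (h : Tendsto (fun k => toWeakSpace ℝ X (x k)) atTop (𝓝 (toWeakSpace ℝ X y)))
    (T : X →L[ℝ] E3) : Tendsto (fun k => T (x k)) atTop (𝓝 (T y)) := by
  have hi (i : Fin 3) : Tendsto (fun k => T (x k) i) atTop (𝓝 (T y i)) :=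
    tendsto_of_weakTendsto h ((EuclideanSpace.proj (𝕜 := ℝ) i).comp T)
  have h1 : Tendsto (fun k => WithLp.ofLp (T (x k))) atTop (𝓝 (WithLp.ofLp (T y))) :=
    tendsto_pi_nhds.2 hi
  exact ((PiLp.continuous_toLp 2 (fun _ : Fin 3 => ℝ)).tendsto _).comp h1

/-- Weakly convergent sequences are bounded, by the uniform boundedness principle. -/
lemma exists_norm_le_of_weakTendsto {X : Type*} [NormedAddCommGroup X] [NormedSpace ℝ X]
    {x : ℕ → X} {y : X}
    (h : Tendsto (fun k => toWeakSpace ℝ X (x k)) atTop (𝓝 (toWeakSpace ℝ X y))) :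
    ∃ C, ∀ k, ‖x k‖ ≤ C := by
  obtain ⟨C, hC⟩ := banach_steinhaus (g := fun k => NormedSpace.inclusionInDoubleDual ℝ X (x k))
    fun T => by
      obtain ⟨C, hC⟩ := (tendsto_of_weakTendsto h T).norm.bddAbove_range
      refine ⟨C, fun k => ?_⟩
      rw [NormedSpace.dual_def]
      exact hC (mem_range_self k)
  refine ⟨C, fun k => ?_⟩
  have : ‖NormedSpace.inclusionInDoubleDual ℝ X (x k)‖ = ‖x k‖ :=
    (NormedSpace.inclusionInDoubleDualLi ℝ (E := X)).norm_map (x k)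
  rw [← this]
  exact hC k

/-! ### Translates of a loop and the loops of nearby configurations -/

lemma IsSmoothLoop.add_const {γ : Circle → E3} (h : IsSmoothLoop γ) (a : E3) :
    IsSmoothLoop fun θ => γ θ + a where
  contDiff := h.contDiff.add contDiff_const
  deriv_ne_zero t := by
    rw [deriv_add_const]
    exact h.deriv_ne_zero t
  injective x y hxy := h.injective (add_right_cancel hxy)

namespace LinkSystem

variable {p : ℝ≥0∞} {Y : LinkSystem p} {Emax : ℝ} {n₁ n₂ : ℤ} {η₁ η₂ : ℝ → E3}

section

variable [Fact (1 ≤ p)] {z : Y.V} (hz : Y.IsAdmissible Emax n₁ n₂ η₁ η₂ z)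

lemma solvesIVP₁ (z : Y.V) :
    SolvesIVP Y.rod₁.L z.1 Y.r₁ Y.u₁ Y.v₁ (Y.frame₁ z) :=
  solvesIVP_solution Y.rod₁.L_pos.le (integrableOn_of_Lp z.1) _ Y.orthonormal_clamp

include hz

lemma IsAdmissible.solvesIVP₂ :
    SolvesIVP Y.rod₂.L z.2.1 z.2.2.1 z.2.2.2.1 z.2.2.2.2.1 (Y.frame₂ z) :=
  solvesIVP_solution Y.rod₂.L_pos.le (integrableOn_of_Lp z.2.1) _ hz.orthonormal

lemma IsAdmissible.isClosedC1On₁ : IsClosedC1On (Y.frame₁ z).r 0 Y.rod₁.L :=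
  (solvesIVP₁ z).isClosedC1On Y.rod₁.L_pos.le hz.closed₁

lemma IsAdmissible.isClosedC1On₂ : IsClosedC1On (Y.frame₂ z).r 0 Y.rod₂.L :=
  hz.solvesIVP₂.isClosedC1On Y.rod₂.L_pos.le hz.closed₂

lemma IsAdmissible.isCompact_Λ : IsCompact (Y.Λ z) :=
  (solvesIVP₁ z).isCompact_body.union hz.solvesIVP₂.isCompact_body

end

/-- The loop `γ + a` has the same linking number with a curve close to `r` as `γ` has with `r`. -/
lemma linkingNumber_add_const_eq {γ : Circle → E3} (hγ : IsSmoothLoop γ) {a : E3} {ε L : ℝ}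
    (hL : 0 ≤ L) (ha : ‖a‖ < ε) {r r' : ℝ → E3} (hr : IsClosedC1On r 0 L)
    (hr' : IsClosedC1On r' 0 L) (hfar : ∀ θ, ∀ s ∈ Icc 0 L, 2 * ε ≤ ‖γ θ - r s‖)
    (hclose : ∀ s ∈ Icc 0 L, ‖r' s - r s‖ < ε) :
    linkingNumber (fun t : ℝ => γ (Circle.exp t) + a) 0 (2 * π) r' 0 L =
      linkingNumber (fun t : ℝ => γ (Circle.exp t)) 0 (2 * π) r 0 L := by
  refine (linkingNumber_eq_of_close (by positivity) hL hγ.isC1Loop.isClosedC1On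
    (hγ.add_const a).isC1Loop.isClosedC1On hr hr' fun s _ t ht => ?_).symm
  rw [add_sub_cancel_left]
  have h1 := hfar (Circle.exp s) t ht
  have h2 := hclose t ht
  linarith

/-- If all material points of the configuration `z'` are within `ε` of their positions in `z`, and
the loop `γ ∈ D[z]` has distance at least `2 ε` from the link `Λ[z]`, then the translates of `γ` by
vectors shorter than `ε` belong to `D[z']`. -/
theorem IsAdmissible.translate_mem_D [Fact (1 ≤ p)] {z z' : Y.V}
    (hz : Y.IsAdmissible Emax n₁ n₂ η₁ η₂ z) (hz' : Y.IsAdmissible Emax n₁ n₂ η₁ η₂ z')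
    {γ : Circle → E3} (hγ : γ ∈ Y.D z) {ε : ℝ}
    (hfar : ∀ θ, ∀ y ∈ Y.Λ z, 2 * ε ≤ ‖γ θ - y‖)
    (hclose₁ : ∀ x ∈ Y.rod₁.Ω, ‖(Y.frame₁ z').position x - (Y.frame₁ z).position x‖ < ε)
    (hclose₂ : ∀ x ∈ Y.rod₂.Ω, ‖(Y.frame₂ z').position x - (Y.frame₂ z).position x‖ < ε)
    {a : E3} (ha : ‖a‖ < ε) : (fun θ => γ θ + a) ∈ Y.D z' := by
  obtain ⟨⟨hsm, -⟩, ⟨h, hh, -⟩, hl₁, hl₂⟩ := hγ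
  have hcont : Continuous γ := by
    have : γ = fun θ => (h θ : E3) := funext fun θ => (hh θ).symm
    rw [this]
    exact continuous_subtype_val.comp h.continuous
  have havoid (θ : Circle) : γ θ + a ∈ (Y.Λ z')ᶜ := by
    intro hmem
    obtain ⟨y, hy, hyε⟩ : ∃ y ∈ Y.Λ z, ‖γ θ + a - y‖ < ε := by
      rcases hmem with ⟨x, hx, e⟩ | ⟨x, hx, e⟩
      · exact ⟨_, Or.inl ⟨x, hx, rfl⟩, e ▸ hclose₁ x hx⟩
      · exact ⟨_, Or.inr ⟨x, hx, rfl⟩, e ▸ hclose₂ x hx⟩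
    have h1 := hfar θ y hy
    have h2 : γ θ - y = (γ θ + a - y) - a := by abel
    have h3 := norm_sub_le (γ θ + a - y) a
    rw [← h2] at h3
    linarith
  have hmid {L : ℝ} {B : Rod p} (hB : B.L = L) {F F' : Frame}
      (hc : ∀ x ∈ B.Ω, ‖F'.position x - F.position x‖ < ε) :
      ∀ s ∈ Icc 0 L, ‖F'.r s - F.r s‖ < ε := fun s hs => by
    have := hc _ (B.mem_Ω_midline (hB ▸ hs))
    rwa [F.position_midline, F'.position_midline] at this
  have l₁ : linkingNumber (fun t : ℝ => γ (Circle.exp t) + a) 0 (2 * π) (Y.frame₁ z').r 0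
      Y.rod₁.L = 1 := by
    rw [← hl₁]
    exact linkingNumber_add_const_eq hsm Y.rod₁.L_pos.le ha hz.isClosedC1On₁ hz'.isClosedC1On₁
      (fun θ s hs => hfar θ _ (Or.inl (Y.rod₁.midline_subset_body _ ⟨s, hs, rfl⟩)))
      (hmid rfl hclose₁)
  have l₂ : linkingNumber (fun t : ℝ => γ (Circle.exp t) + a) 0 (2 * π) (Y.frame₂ z').r 0
      Y.rod₂.L = 1 := by
    rw [← hl₂]
    exact linkingNumber_add_const_eq hsm Y.rod₂.L_pos.le ha hz.isClosedC1On₂ hz'.isClosedC1On₂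
      (fun θ s hs => hfar θ _ (Or.inr (Y.rod₂.midline_subset_body _ ⟨s, hs, rfl⟩)))
      (hmid rfl hclose₂)
  let h' : C(Circle, ↥(Y.Λ z')ᶜ) :=
    ⟨fun θ => ⟨γ θ + a, havoid θ⟩, (hcont.add continuous_const).subtype_mk _⟩
  refine ⟨⟨hsm.add_const a, havoid⟩, ⟨h', fun _ => rfl, ?_⟩, l₁, l₂⟩
  refine not_nullhomotopic_of_linkingNumber_ne_zero h' Y.rod₁.L_pos.le hz'.isClosedC1On₁
    ((Y.rod₁.midline_subset_body _).trans subset_union_left)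
    (hsm.add_const a).isC1Loop.isClosedC1On ?_
  change linkingNumber (fun t : ℝ => γ (Circle.exp t) + a) 0 (2 * π) (Y.frame₁ z').r 0
      Y.rod₁.L ≠ 0
  rw [l₁]
  exact one_ne_zero

/-- Under weak convergence of admissible configurations all material points converge uniformly. -/
theorem WeakTendsto.eventually_position_close [Fact (1 ≤ p)] (hp_one : 1 < p) (hp_top : p ≠ ⊤)
    {zs : ℕ → Y.V} {z : Y.V} (hzs : ∀ k, Y.IsAdmissible Emax n₁ n₂ η₁ η₂ (zs k))
    (hz : Y.IsAdmissible Emax n₁ n₂ η₁ η₂ z) (hw : Y.WeakTendsto zs z) {ε : ℝ} (hε : 0 < ε) :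
    ∀ᶠ k in atTop,
      (∀ x ∈ Y.rod₁.Ω, ‖(Y.frame₁ (zs k)).position x - (Y.frame₁ z).position x‖ < ε) ∧
      ∀ x ∈ Y.rod₂.Ω, ‖(Y.frame₂ (zs k)).position x - (Y.frame₂ z).position x‖ < ε := by
  obtain ⟨C, hC⟩ := exists_norm_le_of_weakTendsto hw
  have hT (T : Y.V →L[ℝ] E3) := tendsto_E3_of_weakTendsto hw T
  let P₁ : Y.V →L[ℝ] Y.rod₁.Density := ContinuousLinearMap.fst ℝ _ _
  let P₂ : Y.V →L[ℝ] Y.rod₂.Density × E3 × E3 × E3 × E3 := ContinuousLinearMap.snd ℝ _ _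
  let Q₁ : Y.V →L[ℝ] Y.rod₂.Density := (ContinuousLinearMap.fst ℝ _ _).comp P₂
  let Q₂ : Y.V →L[ℝ] E3 × E3 × E3 × E3 := (ContinuousLinearMap.snd ℝ _ _).comp P₂
  have h₁ := Y.rod₁.eventually_position_close hp_one hp_top (κs := fun k => (zs k).1) (κ := z.1)
    (fun T => hT (T.comp P₁)) (fun k => (norm_fst_le (zs k)).trans (hC k))
    (tendsto_const_nhds (x := Y.r₁)) (tendsto_const_nhds (x := Y.u₁))
    (tendsto_const_nhds (x := Y.v₁)) (fun _ => Y.orthonormal_clamp) Y.orthonormal_clamp hε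
  have h₂ := Y.rod₂.eventually_position_close hp_one hp_top (κs := fun k => (zs k).2.1)
    (κ := z.2.1) (fun T => hT (T.comp Q₁))
    (fun k => (norm_fst_le (zs k).2).trans ((norm_snd_le (zs k)).trans (hC k)))
    (hT ((ContinuousLinearMap.fst ℝ _ _).comp Q₂))
    (hT ((ContinuousLinearMap.fst ℝ _ _).comp ((ContinuousLinearMap.snd ℝ _ _).comp Q₂)))
    (hT ((ContinuousLinearMap.fst ℝ _ _).comp ((ContinuousLinearMap.snd ℝ _ _).comp
      ((ContinuousLinearMap.snd ℝ _ _).comp Q₂))))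
    (fun k => (hzs k).orthonormal) hz.orthonormal hε
  exact h₁.and h₂

end LinkSystem

/-! ### The area bound and the spanning property of the limit -/

namespace LinkSystem

variable {p : ℝ≥0∞} [Fact (1 ≤ p)] {Y : LinkSystem p} {Emax : ℝ} {n₁ n₂ : ℤ} {η₁ η₂ : ℝ → E3}

/-- The uniform lower bound for the area of spanning sets in all small tubes about a loop
`γ ∈ D[z]`. -/
theorem IsAdmissible.exists_area_lower_bound (hp_one : 1 < p) (hp_top : p ≠ ⊤) {z : Y.V}
    (hz : Y.IsAdmissible Emax n₁ n₂ η₁ η₂ z) {γ : Circle → E3} (hγ : γ ∈ Y.D z) {K : ℝ}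
    (hK : 0 < K) (hlip : ∀ s t : ℝ, ‖γ (Circle.exp s) - γ (Circle.exp t)‖ ≤ K * |s - t|) :
    ∃ ε₀ > 0, ∀ ε > 0, ε ≤ ε₀ → IsTubular γ (2 * ε) ∧ tube γ (2 * ε) ⊆ (Y.Λ z)ᶜ ∧
      ∀ zs : ℕ → Y.V, (∀ k, Y.IsAdmissible Emax n₁ n₂ η₁ η₂ (zs k)) → Y.WeakTendsto zs z →
      ∀ S : ℕ → Set E3, (∀ k, S k ∈ spanningFamily (Y.Λ (zs k)) (Y.D (zs k))) →
        ∀ᶠ k in atTop, ENNReal.ofReal ((volume (Metric.ball (0 : E3) ε)).toReal / sweepConst K) ≤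
          μH[2] (S k ∩ tube γ ε) := by
  have hsm : IsSmoothLoop γ := hγ.1.1
  obtain ⟨r, hr, htub⟩ := hsm.exists_isTubular
  have hdisj : Disjoint (range γ) (Y.Λ z) := by
    rw [Set.disjoint_left]
    rintro _ ⟨θ, rfl⟩ hmem
    exact hγ.1.2 θ hmem
  obtain ⟨δ, hδ, hδd⟩ := hdisj.exists_thickenings hsm.isCompact_range hz.isCompact_Λ.isClosed
  have hfar (θ : Circle) (y : E3) (hy : y ∈ Y.Λ z) : δ ≤ ‖γ θ - y‖ := by
    by_contra! hlt
    have hy' : y ∈ Metric.thickening δ (range γ) :=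
      Metric.mem_thickening_iff.2 ⟨γ θ, mem_range_self θ, by rwa [dist_comm, dist_eq_norm]⟩
    exact Set.disjoint_left.1 hδd hy' (Metric.self_subset_thickening hδ _ hy)
  refine ⟨min r δ / 2, by positivity, fun ε hε hεle => ?_⟩
  have hεr : 2 * ε ≤ r := by linarith [min_le_left r δ]
  have hεδ : 2 * ε ≤ δ := by linarith [min_le_right r δ]
  refine ⟨htub _ hεr, fun x hx hxΛ => ?_, fun zs hzs hw S hS => ?_⟩
  · obtain ⟨_, ⟨θ, rfl⟩, hθ⟩ := Metric.mem_thickening_iff.1 hx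
    rw [dist_comm, dist_eq_norm] at hθ
    linarith [hfar θ x hxΛ]
  · filter_upwards [hw.eventually_position_close hp_one hp_top hzs hz hε] with k hk
    refine le_hausdorffMeasure_of_meets_translates hK hlip fun a ha => ?_
    obtain ⟨x, hx, θ, rfl⟩ := (hS k).2 _ (hz.translate_mem_D (hzs k) hγ
      (fun θ y hy => hεδ.trans (hfar θ y hy)) hk.1 hk.2 ha)
    exact ⟨θ, hx⟩

/-- A weak-star limit of the area measures of spanning sets charges every neighbourhood of every
loop of `D[z]`, so its support meets the loop. -/
theorem IsAdmissible.support_inter_range_nonempty (hp_one : 1 < p) (hp_top : p ≠ ⊤) {z : Y.V}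
    (hz : Y.IsAdmissible Emax n₁ n₂ η₁ η₂ z) {zs : ℕ → Y.V}
    (hzs : ∀ k, Y.IsAdmissible Emax n₁ n₂ η₁ η₂ (zs k)) (hw : Y.WeakTendsto zs z)
    {S : ℕ → Set E3} (hS : ∀ k, S k ∈ spanningFamily (Y.Λ (zs k)) (Y.D (zs k)))
    (hfin : ∀ k, μH[2] (S k) < ⊤) {φ : ℕ → ℕ} (hφ : StrictMono φ) {μ : Measure E3}
    (hμ : WeakStarTendsto (fun j => μH[2].restrict (S (φ j))) μ) {γ : Circle → E3}
    (hγ : γ ∈ Y.D z) : (μ.support ∩ range γ).Nonempty := by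
  by_contra hempty
  have hsm : IsSmoothLoop γ := hγ.1.1
  have hdisj : Disjoint (range γ) μ.support := by
    rw [disjoint_comm, disjoint_iff_inter_eq_empty]
    exact not_nonempty_iff_eq_empty.1 hempty
  obtain ⟨δ, hδ, hδd⟩ := hdisj.exists_cthickenings hsm.isCompact_range μ.isClosed_support
  obtain ⟨K, hK, hlip⟩ := hsm.exists_lipschitz
  obtain ⟨ε₀, hε₀, H⟩ := hz.exists_area_lower_bound hp_one hp_top hγ hK hlip
  set ε := min ε₀ δ
  have hε : 0 < ε := lt_min hε₀ hδ
  obtain ⟨-, -, hlow⟩ := H ε hε (min_le_left _ _)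
  set M := (volume (Metric.ball (0 : E3) ε)).toReal / sweepConst K
  have hM : 0 < M := div_pos
    (ENNReal.toReal_pos (Metric.measure_ball_pos _ _ hε).ne' measure_ball_lt_top.ne)
    (sweepConst_pos hK)
  -- a test function that is `1` on the tube and vanishes on the support of the limit measure
  obtain ⟨f, hf1, hf0, hfc, hf01⟩ := exists_continuous_one_zero_of_isCompact
    (hsm.isCompact_range.cthickening (r := δ)) μ.isClosed_support
    (hδd.mono_right (Metric.self_subset_cthickening _))
  have hlim := hμ ⟨f, hfc⟩
  have hzero : ∫ x, f x ∂μ = 0 := by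
    refine integral_eq_zero_of_ae ?_
    filter_upwards [Measure.support_mem_ae (μ := μ)] with x hx using hf0 hx
  have hge : ∀ᶠ j in atTop, M ≤ ∫ x, f x ∂(μH[2].restrict (S (φ j))) := by
    filter_upwards [hφ.tendsto_atTop.eventually (hlow zs hzs hw S hS)] with j hj
    set ν : Measure E3 := μH[2].restrict (S (φ j)) with hν
    have : IsFiniteMeasure ν := ⟨by rw [hν, Measure.restrict_apply_univ]; exact hfin _⟩
    have hopen : MeasurableSet (tube γ ε) := Metric.isOpen_thickening.measurableSet
    have h1 : M ≤ ν.real (tube γ ε) := by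
      refine (ENNReal.ofReal_le_iff_le_toReal (measure_ne_top _ _)).1 ?_
      rw [hν, Measure.restrict_apply hopen, inter_comm]
      exact hj
    rw [← integral_indicator_one hopen] at h1
    refine h1.trans (integral_mono ?_ (f.continuous.integrable_of_hasCompactSupport hfc) ?_)
    · exact (integrable_const (1 : ℝ)).indicator hopen
    · intro x
      by_cases hx : x ∈ tube γ ε
      · have : x ∈ Metric.cthickening δ (range γ) :=
          Metric.thickening_subset_cthickening_of_le (min_le_right _ _) _ hx
        rw [indicator_of_mem hx, hf1 this]
      · rw [indicator_of_notMem hx]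
        exact (hf01 x).1
  have := ge_of_tendsto hlim hge
  change M ≤ ∫ x, f x ∂μ at this
  linarith

end LinkSystem

end KirchhoffPlateau

open KirchhoffPlateau

theorem mainTheorem3 {p : ℝ≥0∞} [Fact (1 ≤ p)] (hp_one : 1 < p) (hp_top : p ≠ ⊤)
    (Y : LinkSystem p) (Emax : ℝ) (n₁ n₂ : ℤ) (η₁ η₂ : ℝ → E3)
    (hη₁ : ContinuousOn η₁ (Icc 0 Y.rod₁.L)) (hη₁_closed : η₁ 0 = η₁ Y.rod₁.L)
    (hη₂ : ContinuousOn η₂ (Icc 0 Y.rod₂.L)) (hη₂_closed : η₂ 0 = η₂ Y.rod₂.L) :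
    (∀ γ : Circle → E3, ∃ M : ℝ → ℝ, (∀ ε, 0 < ε → 0 < M ε) ∧
      ∀ z : Y.V, Y.IsAdmissible Emax n₁ n₂ η₁ η₂ z → γ ∈ Y.D z →
        ∃ ε > 0, IsTubular γ (2 * ε) ∧ tube γ (2 * ε) ⊆ (Y.Λ z)ᶜ ∧
          ∀ zs : ℕ → Y.V, (∀ k, Y.IsAdmissible Emax n₁ n₂ η₁ η₂ (zs k)) → Y.WeakTendsto zs z →
          ∀ S : ℕ → Set E3, (∀ k, S k ∈ spanningFamily (Y.Λ (zs k)) (Y.D (zs k))) →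
            ∃ k₀, ∀ k ≥ k₀, ENNReal.ofReal (M ε) ≤ μH[2] (S k ∩ tube γ ε)) ∧
    (∀ z : Y.V, Y.IsAdmissible Emax n₁ n₂ η₁ η₂ z →
      ∀ zs : ℕ → Y.V, (∀ k, Y.IsAdmissible Emax n₁ n₂ η₁ η₂ (zs k)) → Y.WeakTendsto zs z →
      ∀ S : ℕ → Set E3, (∀ k, S k ∈ spanningFamily (Y.Λ (zs k)) (Y.D (zs k))) →
        (∀ k, μH[2] (S k) < ⊤) →
      ∀ φ : ℕ → ℕ, StrictMono φ → ∀ μ : Measure E3, IsLocallyFiniteMeasure μ →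
        WeakStarTendsto (fun j => μH[2].restrict (S (φ j))) μ →
        μ.support \ Y.Λ z ∈ spanningFamily (Y.Λ z) (Y.D z)) := by
  refine ⟨fun γ => ?_, fun z hz zs hzs hw S hS hfin φ hφ μ _ hμ => ⟨⟨μ.support, ?_, rfl⟩, ?_⟩⟩
  · by_cases hsm : IsSmoothLoop γ
    · obtain ⟨K, hK, hlip⟩ := hsm.exists_lipschitz
      refine ⟨fun ε => (volume (Metric.ball (0 : E3) ε)).toReal / sweepConst K, fun ε hε => ?_,
        fun z hz hγ => ?_⟩
      · exact div_pos (ENNReal.toReal_pos (Metric.measure_ball_pos _ _ hε).ne'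
          measure_ball_lt_top.ne) (sweepConst_pos hK)
      · obtain ⟨ε₀, hε₀, H⟩ := hz.exists_area_lower_bound hp_one hp_top hγ hK hlip
        obtain ⟨h1, h2, h3⟩ := H ε₀ hε₀ le_rfl
        exact ⟨ε₀, hε₀, h1, h2, fun zs hzs hw S hS =>
          eventually_atTop.1 (h3 zs hzs hw S hS)⟩
    · exact ⟨fun _ => 1, fun _ _ => one_pos, fun z _ hγ => absurd hγ.1.1 hsm⟩
  · exact μ.isClosed_support
  · intro γ hγ
    obtain ⟨x, hx, θ, rfl⟩ :=
      hz.support_inter_range_nonempty hp_one hp_top hzs hw hS hfin hφ hμ hγ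
    exact ⟨γ θ, ⟨hx, hγ.1.2 θ⟩, mem_range_self θ⟩
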